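/- Let $n\ge 2$. Let $2\le k\le\omega$ and $1\le r\le\omega$ be smoothness classes ($C^\infty$ and real analytic $C^\omega$ included). A bounded regular strictly convex domain $\mathcal D\subset\mathbb R^n$ is a nonempty bounded open convex set whose frontier $\mathrm{Fr}\,\mathcal D$ is a regular embedded hypersurface of class $C^k$, all of whose normal curvatures with respect to the inward unit normal are positive. Let $\kappa(\mathcal D)$ be the supremum over $p\in\mathrm{Fr}\,\mathcal D$ of the largest principal curvature of $\mathrm{Fr}\,\mathcal D$ at $p$ (with respect to the inward unit normal). For two such domains with $\overline{\mathcal D}\subset\mathcal D'$, put $d_0=\mathrm{dist}(\mathcal D,\mathrm{Fr}\,\mathcal D')$ and \[ \mathbf d(\mathcal D,\mathrm{Fr}\,\mathcal D')=\Big(d_0+\frac1{\kappa(\mathcal D)}\Big)\sqrt{\frac{d_0}{d_0+2/\kappa(\mathcal D)}} . \] A tangent net of radius $\delta>0$ for $\mathcal D$ is a set $\mathcal T=\{q\in\mathbb R^n:\mathrm{dist}(q,\Gamma)<\delta\}$ with $\Gamma=\bigcup_{p\in\Delta}(p+T_p\,\mathrm{Fr}\,\mathcal D)$ for some finite set $\Delta\subset\mathrm{Fr}\,\mathcal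 D$ (with $\mathcal T=\emptyset$ if $\Delta=\emptyset$). **Lemma.** Let $\mathcal D,\mathcal D'$ be bounded regular strictly convex domains in $\mathbb R^n$ with $\overline{\mathcal D}\subset\mathcal D'$, and let $A\subset\mathrm{Fr}\,\mathcal D$ be the union of a finite collection of immersed compact arcs and immersed closed curves of class $C^r$. Then for every $\varepsilon>0$ there is a tangent net $\mathcal T$ for $\mathcal D$ of radius less than $\varepsilon$ such that (i) $A\subset\mathcal T$, and (ii) every Jordan arc $\gamma\subset\mathcal T$ with one endpoint in $\mathrm{Fr}\,\mathcal D$ and the other in $\mathrm{Fr}\,\mathcal D'$ has length $\ell(\gamma)>\mathbf d(\mathcal D,\mathrm{Fr}\,\mathcal D')-\varepsilon$ (the length may be infinite). -/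

import Mathlib

open Set Filter Topology
open scoped RealInnerProductSpace ContDiff

noncomputable section

namespace TangentNet

/-- Euclidean space of dimension n, with its Euclidean norm. -/
abbrev E (n : ℕ) : Type := EuclideanSpace ℝ (Fin n)

variable {n : ℕ}

/-- `S` is a regular (embedded) hypersurface of class `C^k`: near each of its points it is the zero
set of a function of class `C^k` without critical points. -/
def IsRegularHypersurface (k : WithTop ℕ∞) (S : Set (E n)) : Prop :=
  ∀ p ∈ S, ∃ (U : Set (E n)) (ρ : E n → ℝ), IsOpen U ∧ p ∈ U ∧ ContDiffOn ℝ k ρ U ∧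
    (∀ x ∈ U, fderiv ℝ ρ x ≠ 0) ∧ S ∩ U = {x ∈ U | ρ x = 0}

/-- `c` is a curve in `S` that passes at time `0` through `p` with velocity `v`. -/
def IsCurveThrough (S : Set (E n)) (p v : E n) (c : ℝ → E n) : Prop :=
  c 0 = p ∧ (∀ᶠ t in 𝓝 (0 : ℝ), c t ∈ S) ∧ HasDerivAt c v 0

/-- The tangent space `T_p S`: all velocities at `p` of curves in `S`. -/
def tangentSpace (S : Set (E n)) (p : E n) : Set (E n) :=
  {v | ∃ c : ℝ → E n, IsCurveThrough S p v c}

/-- The affine tangent space `p + T_p S`. -/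
def affineTangentSpace (S : Set (E n)) (p : E n) : Set (E n) :=
  (fun v => p + v) '' tangentSpace S p

/-- `ν` is the outward pointing unit normal of the frontier of `D` at `p`. -/
def IsOutwardUnitNormal (D : Set (E n)) (p ν : E n) : Prop :=
  ‖ν‖ = 1 ∧ (∀ v ∈ tangentSpace (frontier D) p, ⟪ν, v⟫ = 0) ∧
    ∀ᶠ t in 𝓝[>] (0 : ℝ), p + t • ν ∉ closure D

/-- `κ` is the normal curvature of the frontier of `D` at `p` in the direction of the unit tangent
vector `v`, with respect to the inward unit normal: `κ = ⟪dν_p(v), v⟫`, where `ν` is the outward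
unit normal field and `dν_p(v)` is its derivative along a curve in the frontier
with velocity `v` at `p`. -/
def HasNormalCurvature (D : Set (E n)) (p v : E n) (κ : ℝ) : Prop :=
  ∃ (c N : ℝ → E n) (w : E n), IsCurveThrough (frontier D) p v c ∧
    (∀ᶠ t in 𝓝 (0 : ℝ), IsOutwardUnitNormal D (c t) (N t)) ∧
    HasDerivAt N w 0 ∧ κ = ⟪w, v⟫

/-- The largest principal curvature at `p`: the largest normal curvature over all unit
tangent directions at `p`. -/
def maxCurvatureAt (D : Set (E n)) (p : E n) : ℝ :=
  sSup {κ | ∃ v ∈ tangentSpace (frontier D) p, ‖v‖ = 1 ∧ HasNormalCurvature D p v κ}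

/-- `κ(D)`, the supremum over the frontier of the largest principal curvature. -/
def maxCurvature (D : Set (E n)) : ℝ :=
  sSup (maxCurvatureAt D '' frontier D)

/-- Bounded regular strictly convex domains, of class `C^k`. -/
structure IsBoundedRegularStrictlyConvexDomain (k : WithTop ℕ∞) (D : Set (E n)) : Prop where
  isOpen : IsOpen D
  nonempty : D.Nonempty
  convex : Convex ℝ D
  bounded : Bornology.IsBounded D
  regular : IsRegularHypersurface k (frontier D)
  strict : ∀ p ∈ frontier D, ∀ v ∈ tangentSpace (frontier D) p, ‖v‖ = 1 →
    ∀ κ, HasNormalCurvature D p v κ → 0 < κ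

/-- `D ⋐ D'`. -/
def RelativelyCompactIn (D D' : Set (E n)) : Prop :=
  IsCompact (closure D) ∧ closure D ⊆ D'

/-- The distance between two sets. -/
def setDist (A B : Set (E n)) : ℝ :=
  sInf (image2 dist A B)

/-- The distance type function
`(d + 1/κ) * √(d / (d + 2/κ))` with `d = dist(D, Fr D')` and `κ = κ(D)`. -/
def boldDist (D D' : Set (E n)) : ℝ :=
  (setDist D (frontier D') + 1 / maxCurvature D) *
    √(setDist D (frontier D') / (setDist D (frontier D') + 2 / maxCurvature D))

/-- `T` is a tangent net of radius `δ` for `D`: the open `δ`-neighbourhood of the union of the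
affine tangent hyperplanes at finitely many points of the frontier of `D`. -/
def IsTangentNet (D : Set (E n)) (δ : ℝ) (T : Set (E n)) : Prop :=
  0 < δ ∧ ∃ Δ : Finset (E n), (Δ : Set (E n)) ⊆ frontier D ∧
    T = Metric.thickening δ (⋃ p ∈ Δ, affineTangentSpace (frontier D) p)

/-- `α` is an immersed compact arc of class `C^r`. -/
def IsImmersedCompactArc (r : WithTop ℕ∞) (α : Set (E n)) : Prop :=
  ∃ (a b : ℝ) (c : ℝ → E n), a < b ∧ ContDiffOn ℝ r c (Icc a b) ∧
    (∀ t ∈ Icc a b, derivWithin c (Icc a b) t ≠ 0) ∧ α = c '' Icc a b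

/-- `α` is an immersed closed curve of class `C^r`. -/
def IsImmersedClosedCurve (r : WithTop ℕ∞) (α : Set (E n)) : Prop :=
  ∃ (L : ℝ) (c : ℝ → E n), 0 < L ∧ Function.Periodic c L ∧ ContDiff ℝ r c ∧
    (∀ t, deriv c t ≠ 0) ∧ α = range c

/-- `γ`, restricted to `[0,1]`, parametrizes a Jordan arc. -/
def IsJordanArc (γ : ℝ → E n) : Prop :=
  ContinuousOn γ (Icc 0 1) ∧ InjOn γ (Icc 0 1)

end TangentNet

end

noncomputable section

namespace TangentNet

variable {n : ℕ}

/-! Put `R = 1 / maxCurvature D`. At a point `x` outside the closure of `D`, the distance to `D`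
increases fastest along the outward unit normal `u` at the point `y` of the closure nearest to `x`.
By Blaschke's rolling theorem (`IsSupport.inner_sub_le`) the ball of radius `R` internally tangent
at `y` lies behind every supporting hyperplane of `D`. If `x` is within `δ` of such a hyperplane
with normal `v`, and within `d` of `D`, this forces `⟪u, v⟫ ≥ (R - δ) / (R + d)`. Hence inside a
slab of the net the distance to `D` grows at rate at most `√(1 - ((R - δ) / (R + d)) ^ 2)`, up to an
error `2 * δ` for motion across the slab (`IsSupport.infDist_sub_infDist_le`). For `δ = 0`, dividing
`d` by this rate gives exactly `boldDist` (`sqrt_mul_eq`).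

A curve may change slabs arbitrarily often, but passing at once to the last visit of the current
slab leaves at most one error per slab (`sub_le_of_finite_cover`). The frontier departs only
quadratically from its tangent hyperplanes, so on Lipschitz arcs `O(M)` tangency points allow the
radius `C / M ^ 2` (`exists_net_covering`), and the total error is `O(1 / M)`.

For the rolling theorem, the curvature bound puts balls of radius `r < R` locally inside `D`. So the
support function minus `r * ‖w‖` has local linear minorants at nonzero vectors, and along segments
missing the origin these are global. -/

/-! ### Supporting hyperplanes and normals -/

/-- `u` is a unit outer normal of a supporting hyperplane of `D` at the frontier point `p`. -/
structure IsSupport (D : Set (E n)) (p u : E n) : Prop where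
  mem : p ∈ frontier D
  norm_eq : ‖u‖ = 1
  inner_le : ∀ z ∈ D, ⟪u, z - p⟫ ≤ 0

lemma IsSupport.inner_le_closure {D : Set (E n)} {p u : E n} (h : IsSupport D p u) :
    ∀ z ∈ closure D, ⟪u, z - p⟫ ≤ 0 := by
  have hc : IsClosed {z : E n | ⟪u, z - p⟫ ≤ 0} :=
    isClosed_le (by fun_prop) continuous_const
  exact fun z hz => closure_minimal h.inner_le hc hz

lemma IsSupport.inner_lt {D : Set (E n)} {p u z : E n} (h : IsSupport D p u) (hD : IsOpen D)
    (hz : z ∈ D) : ⟪u, z - p⟫ < 0 := by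
  have hlim : Tendsto (fun t : ℝ => z + t • u) (𝓝[>] 0) (𝓝 z) := by
    have : Continuous fun t : ℝ => z + t • u := by fun_prop
    simpa using (this.tendsto 0).mono_left nhdsWithin_le_nhds
  obtain ⟨t, ht, ht0⟩ := ((hlim.eventually (hD.mem_nhds hz)).and self_mem_nhdsWithin).exists
  have h1 := h.inner_le _ ht
  have h2 : ⟪u, z + t • u - p⟫ = ⟪u, z - p⟫ + t := by
    rw [show z + t • u - p = (z - p) + t • u by abel, inner_add_right, inner_smul_right,
      real_inner_self_eq_norm_sq, h.norm_eq]; ring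
  have h3 : (0 : ℝ) < t := ht0
  linarith

lemma exists_isSupport {D : Set (E n)} {p : E n} (hD : IsOpen D) (hc : Convex ℝ D)
    (hne : D.Nonempty) (hp : p ∈ frontier D) : ∃ u, IsSupport D p u := by
  have hpD : p ∉ D := fun h => by
    rw [hD.frontier_eq] at hp; exact hp.2 h
  obtain ⟨f, hf⟩ := geometric_hahn_banach_open_point hc hD hpD
  set w : E n := (InnerProductSpace.toDual ℝ (E n)).symm f with hw
  have hwf : ∀ z, ⟪w, z⟫ = f z := fun z => by
    rw [hw, InnerProductSpace.toDual_symm_apply]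
  have hw0 : w ≠ 0 := by
    intro h0
    obtain ⟨z, hz⟩ := hne
    have := hf z hz
    rw [← hwf, ← hwf, h0] at this
    simp at this
  refine ⟨‖w‖⁻¹ • w, hp, ?_, fun z hz => ?_⟩
  · rw [norm_smul, norm_inv, norm_norm, inv_mul_cancel₀ (norm_ne_zero_iff.2 hw0)]
  · rw [real_inner_smul_left, hwf, map_sub]
    exact mul_nonpos_of_nonneg_of_nonpos (by positivity) (by linarith [hf z hz])

lemma IsSupport.inner_tangent {D : Set (E n)} {p u v : E n} (h : IsSupport D p u)
    (hv : v ∈ tangentSpace (frontier D) p) : ⟪u, v⟫ = 0 := by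
  obtain ⟨c, hc0, hcS, hcd⟩ := hv
  have hd : HasDerivAt (fun t => ⟪u, c t - p⟫) ⟪u, v⟫ 0 := by
    have := (hasDerivAt_const (0 : ℝ) u).inner ℝ (hcd.sub_const p)
    simpa using this
  have hmax : IsLocalMax (fun t => ⟪u, c t - p⟫) 0 := by
    filter_upwards [hcS] with t ht
    have := h.inner_le_closure _ (frontier_subset_closure ht)
    simpa [hc0] using this
  exact hmax.hasDerivAt_eq_zero hd

lemma IsSupport.isOutwardUnitNormal {D : Set (E n)} {p u : E n} (h : IsSupport D p u) :
    IsOutwardUnitNormal D p u := by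
  refine ⟨h.norm_eq, fun v hv => h.inner_tangent hv, ?_⟩
  filter_upwards [self_mem_nhdsWithin] with t ht hmem
  have h1 := h.inner_le_closure _ hmem
  rw [add_sub_cancel_left, inner_smul_right, real_inner_self_eq_norm_sq, h.norm_eq] at h1
  have : (0 : ℝ) < t := ht
  linarith

/-! ### Local defining functions with outward gradient -/

/-- By the implicit function theorem, kernel vectors of the differential of a local defining
function are tangent vectors. -/
lemma mem_tangentSpace_of_fderiv_eq_zero {S U : Set (E n)} {ρ : E n → ℝ} {f' : E n →L[ℝ] ℝ}
    {p v : E n} (hU : IsOpen U) (hpU : p ∈ U) (hp : p ∈ S) (hS : S ∩ U = {x ∈ U | ρ x = 0})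
    (hρ : HasStrictFDerivAt ρ f' p) (hf' : f' ≠ 0) (hv : f' v = 0) : v ∈ tangentSpace S p := by
  have hr : f'.range = ⊤ := by
    rw [LinearMap.range_eq_top]
    exact LinearMap.surjective (fun h0 => hf' (by ext x; exact LinearMap.congr_fun h0 x))
  have hρp : ρ p = 0 := by
    have : p ∈ S ∩ U := ⟨hp, hpU⟩
    rw [hS] at this; exact this.2
  let w : f'.ker := ⟨v, hv⟩
  let c : ℝ → E n := fun t => hρ.implicitFunction ρ f' hr (ρ p) (t • w)
  have hd : HasDerivAt c v 0 := by
    have h1 := (hρ.to_implicitFunction hr).hasFDerivAt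
    have h2 : HasDerivAt (fun t : ℝ => t • w) w 0 := by
      simpa using (hasDerivAt_id (0 : ℝ)).smul_const w
    have h3 : HasFDerivAt (hρ.implicitFunction ρ f' hr (ρ p)) f'.ker.subtypeL
      ((fun t : ℝ => t • w) 0) := by simpa using h1
    exact h3.comp_hasDerivAt (0 : ℝ) h2
  have hc0 : c 0 = p := by simp [c]
  refine ⟨c, hc0, ?_, hd⟩
  have hw0 : Tendsto (fun t : ℝ => (ρ p, t • w)) (𝓝 0) (𝓝 (ρ p, 0)) := by
    have : Continuous fun t : ℝ => (ρ p, t • w) := by fun_prop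
    simpa using this.tendsto 0
  have h1 := hw0.eventually (hρ.map_implicitFunction_eq hr)
  have h2 : ∀ᶠ t in 𝓝 0, c t ∈ U :=
    hd.continuousAt.eventually_mem (by rw [hc0]; exact hU.mem_nhds hpU)
  filter_upwards [h1, h2] with t ht htU
  have : c t ∈ S ∩ U := by
    rw [hS]; exact ⟨htU, ht.trans hρp⟩
  exact this.1

/-- `ρ` is a local defining function near `p` of the frontier of the convex domain `D`, with
gradient `g` pointing outward. -/
structure IsLocalDefining (D : Set (E n)) (p : E n) (U : Set (E n)) (ρ : E n → ℝ)
    (g : E n → E n) : Prop where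
  isOpen : IsOpen U
  mem : p ∈ U
  zero : frontier D ∩ U = {x ∈ U | ρ x = 0}
  strict : ∀ x ∈ U, HasStrictFDerivAt ρ (innerSL ℝ (g x)) x
  contDiff : ContDiffOn ℝ 1 g U
  ne : ∀ x ∈ U, g x ≠ 0
  isSupport : ∀ q ∈ frontier D ∩ U, IsSupport D q (‖g q‖⁻¹ • g q)
  eq_of_isSupport : ∀ q ∈ frontier D ∩ U, ∀ u, IsSupport D q u → u = ‖g q‖⁻¹ • g q

/-- A Lagrange multiplier argument: kernel vectors of the differential are tangent, hence orthogonal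
to `u`, so `u` is proportional to the gradient. -/
lemma IsSupport.exists_gradient_eq {D U : Set (E n)} {ρ : E n → ℝ} {p u g : E n}
    (h : IsSupport D p u) (hU : IsOpen U) (hpU : p ∈ U)
    (hS : frontier D ∩ U = {x ∈ U | ρ x = 0})
    (hρ : HasStrictFDerivAt ρ (innerSL ℝ g) p) (hg : g ≠ 0) : ∃ a : ℝ, g = a • u := by
  have hne : innerSL ℝ g ≠ 0 := fun h0 => hg (by
    have : innerSL ℝ g g = 0 := by rw [h0]; simp
    simpa using this)
  have hker : ∀ v, ⟪g, v⟫ = 0 → ⟪u, v⟫ = 0 := fun v hv =>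
    h.inner_tangent (mem_tangentSpace_of_fderiv_eq_zero hU hpU h.mem hS hρ hne (by simpa using hv))
  have hgg : ⟪g, g⟫ ≠ 0 := by simpa using hg
  have hu : ∀ v, ⟪u, v⟫ = (⟪u, g⟫ / ⟪g, g⟫) * ⟪g, v⟫ := fun v => by
    have h1 := hker (v - (⟪g, v⟫ / ⟪g, g⟫) • g) (by
      rw [inner_sub_right, inner_smul_right]; field_simp; ring)
    rw [inner_sub_right, inner_smul_right] at h1
    field_simp at h1 ⊢; linarith
  have hu' : u = (⟪u, g⟫ / ⟪g, g⟫) • g := by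
    refine ext_inner_right ℝ fun v => ?_
    rw [hu v, real_inner_smul_left]
  have hne' : ⟪u, g⟫ / ⟪g, g⟫ ≠ 0 := fun h0 => by
    rw [h0, zero_smul] at hu'
    have := h.norm_eq
    rw [hu'] at this; simp at this
  exact ⟨(⟪u, g⟫ / ⟪g, g⟫)⁻¹, by
    conv_rhs => rw [hu']
    rw [smul_smul, real_inner_smul_left, mul_div_assoc, div_self hgg, mul_one, inv_mul_cancel₀ hne',
      one_smul]⟩

lemma exists_isLocalDefining {k : WithTop ℕ∞} (hk : 2 ≤ k) {D : Set (E n)}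
    (hD : IsBoundedRegularStrictlyConvexDomain k D) {p : E n} (hp : p ∈ frontier D) :
    ∃ U ρ g, IsLocalDefining D p U ρ g := by
  obtain ⟨V, ρ₀, hV, hpV, hρ₀, hne₀, hS₀⟩ := hD.regular p hp
  obtain ⟨z, hz⟩ := hD.nonempty
  obtain ⟨u, hu⟩ := exists_isSupport hD.isOpen hD.convex ⟨z, hz⟩ hp
  replace hρ₀ := hρ₀.of_le hk
  let T := (InnerProductSpace.toDual ℝ (E n)).symm
  let g₀ : E n → E n := fun x => T (fderiv ℝ ρ₀ x)
  have hg₀ : ∀ x, innerSL ℝ (g₀ x) = fderiv ℝ ρ₀ x := fun x => by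
    ext v; simp [g₀, T]
  have hst : ∀ x ∈ V, HasStrictFDerivAt ρ₀ (innerSL ℝ (g₀ x)) x := fun x hx => by
    rw [hg₀]
    exact (hρ₀.contDiffAt (hV.mem_nhds hx)).hasStrictFDerivAt (by norm_num)
  have hcd : ContDiffOn ℝ 1 g₀ V :=
    T.contDiff.comp_contDiffOn (hρ₀.fderiv_of_isOpen hV (by norm_num))
  have hgne : ∀ x ∈ V, g₀ x ≠ 0 := fun x hx h0 => hne₀ x hx (by rw [← hg₀, h0]; simp)
  obtain ⟨a, ha⟩ := hu.exists_gradient_eq hV hpV hS₀ (hst p hpV) (hgne p hpV)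
  have ha0 : a ≠ 0 := fun h0 => hgne p hpV (by rw [ha, h0, zero_smul])
  let g : E n → E n := fun x => a • g₀ x
  have hgc : ContinuousOn (fun x => ⟪g x, z - x⟫) V :=
    (hcd.continuousOn.const_smul a).inner (by fun_prop)
  have hgp : ⟪g p, z - p⟫ < 0 := by
    have : ⟪g p, z - p⟫ = a * a * ⟪u, z - p⟫ := by
      simp only [g]; rw [ha, smul_smul, real_inner_smul_left]
    rw [this]
    exact mul_neg_of_pos_of_neg (mul_self_pos.2 ha0) (hu.inner_lt hD.isOpen hz)
  have hst' : ∀ x ∈ V, HasStrictFDerivAt (fun x => a * ρ₀ x) (innerSL ℝ (g x)) x := fun x hx => by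
    have heq : innerSL ℝ (g x) = a • innerSL ℝ (g₀ x) := by ext v; simp [g]
    rw [heq]
    exact (hst x hx).const_mul a
  have hS : frontier D ∩ V = {x ∈ V | a * ρ₀ x = 0} := by
    rw [hS₀]; ext x; simp [ha0]
  have hgne' : ∀ x ∈ V, g x ≠ 0 := fun x hx => smul_ne_zero ha0 (hgne x hx)
  -- An outward gradient must be negative towards the interior point `z`. The factor `a` arranges
  -- this at `p`, and shrinking `V` keeps it nearby, which fixes the sign of the normal on all of
  -- `U`.
  let U := V ∩ (fun x => ⟪g x, z - x⟫) ⁻¹' Iio 0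
  have huniq : ∀ q ∈ frontier D ∩ U, ∀ u, IsSupport D q u → u = ‖g q‖⁻¹ • g q := by
    rintro q ⟨hq, hqV, hqg⟩ w hw
    obtain ⟨b, hb⟩ := hw.exists_gradient_eq hV hqV hS (hst' q hqV) (hgne' q hqV)
    have h1 := hw.inner_lt hD.isOpen hz
    have h2 : b * ⟪w, z - q⟫ < 0 := by
      have : ⟪g q, z - q⟫ < 0 := hqg
      rwa [hb, real_inner_smul_left] at this
    have hb0 : 0 < b := pos_of_mul_neg_left h2 h1.le
    rw [hb, norm_smul, hw.norm_eq, mul_one, smul_smul, Real.norm_of_nonneg hb0.le,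
      inv_mul_cancel₀ hb0.ne', one_smul]
  refine ⟨U, fun x => a * ρ₀ x, g, hgc.isOpen_inter_preimage hV isOpen_Iio, ⟨hpV, hgp⟩, ?_,
    fun x hx => hst' x hx.1, (hcd.const_smul a).mono inter_subset_left, fun x hx => hgne' x hx.1,
    fun q hq => ?_, huniq⟩
  · rw [← inter_assoc, hS]; ext x; simp [U]; tauto
  · obtain ⟨w, hw⟩ := exists_isSupport hD.isOpen hD.convex ⟨z, hz⟩ hq.1
    rw [← huniq q hq w hw]; exact hw

/-- The tangent space of the frontier is the orthogonal complement of the unit normal. -/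
lemma IsLocalDefining.mem_tangentSpace {D U : Set (E n)} {ρ : E n → ℝ} {g : E n → E n}
    {p q v : E n} (h : IsLocalDefining D p U ρ g) (hq : q ∈ frontier D ∩ U) (hv : ⟪g q, v⟫ = 0) :
    v ∈ tangentSpace (frontier D) q := by
  refine mem_tangentSpace_of_fderiv_eq_zero h.isOpen hq.2 hq.1 h.zero (h.strict q hq.2) ?_
    (by simpa using hv)
  intro h0
  have : innerSL ℝ (g q) (g q) = 0 := by rw [h0]; simp
  exact h.ne q hq.2 (by simpa using this)

lemma IsSupport.mem_tangentSpace {k : WithTop ℕ∞} (hk : 2 ≤ k) {D : Set (E n)}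
    (hD : IsBoundedRegularStrictlyConvexDomain k D) {p u v : E n} (hu : IsSupport D p u)
    (hv : ⟪u, v⟫ = 0) : v ∈ tangentSpace (frontier D) p := by
  obtain ⟨U, ρ, g, h⟩ := exists_isLocalDefining hk hD hu.mem
  refine h.mem_tangentSpace ⟨hu.mem, h.mem⟩ ?_
  have h1 := h.eq_of_isSupport p ⟨hu.mem, h.mem⟩ u hu
  rw [h1, real_inner_smul_left] at hv
  exact (mul_eq_zero.1 hv).resolve_left (inv_ne_zero (norm_ne_zero_iff.2 (h.ne p h.mem)))

lemma IsLocalDefining.of_mem {D U : Set (E n)} {ρ : E n → ℝ} {g : E n → E n} {p q : E n}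
    (h : IsLocalDefining D p U ρ g) (hq : q ∈ U) : IsLocalDefining D q U ρ g :=
  { h with mem := hq }

lemma IsLocalDefining.hasFDerivAt_gradient {D U : Set (E n)} {ρ : E n → ℝ} {g : E n → E n}
    {p : E n} (h : IsLocalDefining D p U ρ g) : HasFDerivAt g (fderiv ℝ g p) p :=
  ((h.contDiff.differentiableOn (by norm_num)).differentiableAt
    (h.isOpen.mem_nhds h.mem)).hasFDerivAt

/-! ### Taylor expansion and internally tangent balls -/

/-- Second order Taylor expansion of a local defining function. -/
lemma IsLocalDefining.exists_taylor {D U : Set (E n)} {ρ : E n → ℝ} {g : E n → E n} {p : E n}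
    (h : IsLocalDefining D p U ρ g) (hp : p ∈ frontier D) {ε : ℝ} (hε : 0 < ε) :
    ∃ η > 0, ∀ w : E n, ‖w‖ < η → p + w ∈ U ∧
      |ρ (p + w) - ⟪g p, w⟫ - ⟪fderiv ℝ g p w, w⟫ / 2| ≤ ε * ‖w‖ ^ 2 := by
  have hρp : ρ p = 0 := by
    have : p ∈ frontier D ∩ U := ⟨hp, h.mem⟩
    rw [h.zero] at this; exact this.2
  have h1 := (hasFDerivAt_iff_isLittleO_nhds_zero.1 h.hasFDerivAt_gradient).def hε
  have h2 : ∀ᶠ w in 𝓝 (0 : E n), p + w ∈ U := by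
    have hc : Continuous fun w : E n => p + w := by fun_prop
    exact hc.continuousAt.eventually_mem (h.isOpen.mem_nhds (by simpa using h.mem))
  obtain ⟨η, hη, hball⟩ := Metric.eventually_nhds_iff.1 (h1.and h2)
  refine ⟨η, hη, fun w hw => ⟨(hball (by simpa using hw)).2, ?_⟩⟩
  have hsmall : ∀ t ∈ Icc (0 : ℝ) 1, ‖t • w‖ ≤ ‖w‖ := fun t ht => by
    rw [norm_smul, Real.norm_of_nonneg ht.1]
    exact mul_le_of_le_one_left (norm_nonneg _) ht.2
  set φ : ℝ → ℝ := fun t => ρ (p + t • w) - t * ⟪g p, w⟫ - t ^ 2 / 2 * ⟪fderiv ℝ g p w, w⟫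
  have hd : ∀ t ∈ Icc (0 : ℝ) 1, HasDerivWithinAt φ
      (⟪g (p + t • w) - g p - fderiv ℝ g p (t • w), w⟫) (Icc 0 1) t := fun t ht => by
    have hU := (hball (y := t • w) (by simpa using (hsmall t ht).trans_lt hw)).2
    have hline : HasDerivAt (fun t : ℝ => p + t • w) w t := by
      simpa using ((hasDerivAt_id t).smul_const w).const_add p
    have e1 : HasDerivAt (fun t : ℝ => ρ (p + t • w)) ⟪g (p + t • w), w⟫ t := by
      simpa [Function.comp_def] using HasFDerivAt.comp_hasDerivAt (f := fun t : ℝ => p + t • w) t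
        (h.strict _ hU).hasFDerivAt hline
    have e2 : HasDerivAt (fun t : ℝ => t * ⟪g p, w⟫) ⟪g p, w⟫ t := by
      simpa using (hasDerivAt_id t).mul_const ⟪g p, w⟫
    have e3 : HasDerivAt (fun t : ℝ => t ^ 2 / 2 * ⟪fderiv ℝ g p w, w⟫)
        (t * ⟪fderiv ℝ g p w, w⟫) t := by
      have := (((hasDerivAt_id t).pow 2).div_const 2).mul_const ⟪fderiv ℝ g p w, w⟫
      refine this.congr_deriv ?_
      simp
    refine (((e1.sub e2).sub e3).congr_deriv ?_).hasDerivWithinAt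
    rw [inner_sub_left, inner_sub_left, map_smul, real_inner_smul_left]
  have hb : ∀ t ∈ Ico (0 : ℝ) 1, ‖⟪g (p + t • w) - g p - fderiv ℝ g p (t • w), w⟫‖
      ≤ ε * ‖w‖ ^ 2 := fun t ht => by
    have ht' : t ∈ Icc (0 : ℝ) 1 := Ico_subset_Icc_self ht
    have h3 := (hball (y := t • w) (by simpa using (hsmall t ht').trans_lt hw)).1
    calc _ ≤ ‖g (p + t • w) - g p - fderiv ℝ g p (t • w)‖ * ‖w‖ := norm_inner_le_norm _ _
      _ ≤ (ε * ‖w‖) * ‖w‖ := by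
        gcongr
        exact h3.trans (by gcongr; exact hsmall t ht')
      _ = _ := by ring
  have := norm_image_sub_le_of_norm_deriv_le_segment_01' hd hb
  simpa [φ, hρp, div_eq_inv_mul] using this

/-- A convex piece of a ball which is tangent to the frontier from inside and does not meet the
frontier lies in the domain. -/
lemma IsSupport.ball_inter_ball_subset {D : Set (E n)} {p u : E n} (hu : IsSupport D p u)
    (hD : IsOpen D) (hc : Convex ℝ D) (hne : D.Nonempty) {r η : ℝ} (hr : 0 < r) (hη : 0 < η)
    (hdisj : ∀ x ∈ Metric.ball (p - r • u) r ∩ Metric.ball p η, x ∉ frontier D) :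
    Metric.ball (p - r • u) r ∩ Metric.ball p η ⊆ D := by
  have hconn : IsPreconnected (Metric.ball (p - r • u) r ∩ Metric.ball p η) :=
    ((convex_ball _ _).inter (convex_ball _ _)).isPreconnected
  refine hconn.subset_left_of_subset_union hD isClosed_closure.isOpen_compl
    (disjoint_compl_right.mono_left subset_closure) (fun x hx => ?_) ?_
  · by_cases hxD : x ∈ D
    · exact Or.inl hxD
    · refine Or.inr fun hcl => hdisj x hx ?_
      rw [hD.frontier_eq]; exact ⟨hcl, hxD⟩
  · obtain ⟨z, hz⟩ := hne
    have hneg := hu.inner_lt hD hz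
    -- After division by `t`, this says that `p + t • (z - p)` lies in the ball of radius `r`. That
    -- point is also in `D`, so the connected intersection of balls meets `D`.
    have l1 : ∀ᶠ t in 𝓝[>] (0 : ℝ), t * ‖z - p‖ ^ 2 + 2 * r * ⟪u, z - p⟫ < 0 := by
      have hcont : Continuous fun t : ℝ => t * ‖z - p‖ ^ 2 + 2 * r * ⟪u, z - p⟫ := by fun_prop
      refine (hcont.continuousAt.eventually_lt_const ?_).filter_mono nhdsWithin_le_nhds
      have : 0 < 2 * r := by positivity
      nlinarith
    have l2 : ∀ᶠ t in 𝓝[>] (0 : ℝ), p + t • (z - p) ∈ Metric.ball p η := by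
      have hcont : Continuous fun t : ℝ => p + t • (z - p) := by fun_prop
      exact (hcont.continuousAt.eventually_mem (Metric.isOpen_ball.mem_nhds
        (by simpa using hη))).filter_mono nhdsWithin_le_nhds
    have l3 : ∀ᶠ t in 𝓝[>] (0 : ℝ), t < 1 :=
      (eventually_lt_nhds one_pos).filter_mono nhdsWithin_le_nhds
    obtain ⟨t, ⟨⟨h1, h2⟩, h3⟩, h4⟩ := (((l1.and l2).and l3).and self_mem_nhdsWithin).exists
    have h0 : 0 < t := h4
    refine ⟨p + t • (z - p), ⟨?_, h2⟩, ?_⟩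
    · rw [mem_ball_iff_norm, show p + t • (z - p) - (p - r • u) = t • (z - p) + r • u by abel]
      refine lt_of_pow_lt_pow_left₀ 2 hr.le ?_
      rw [norm_add_sq_real, norm_smul, norm_smul, hu.norm_eq, real_inner_smul_left,
        inner_smul_right, real_inner_comm, Real.norm_of_nonneg hr.le, Real.norm_of_nonneg h0.le]
      nlinarith
    · have := hc.add_smul_sub_mem_interior' (frontier_subset_closure hu.mem)
        (by rwa [hD.interior_eq] : z ∈ interior D) ⟨h0, h3.le⟩
      rwa [hD.interior_eq] at this

/-- A bound of a quadratic form on the orthogonal complement of `u` gives a bound of its values at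
all vectors, up to an error controlled by the `u`-component. -/
lemma inner_apply_self_le (B : E n →L[ℝ] E n) {u w : E n} (hu : ‖u‖ = 1) {τ k : ℝ}
    (hτ : ⟪u, w⟫ = -τ) (hτ0 : 0 ≤ τ) (hk : 0 ≤ k)
    (hB : ∀ v, ⟪u, v⟫ = 0 → ⟪B v, v⟫ ≤ k * ‖v‖ ^ 2) :
    ⟪B w, w⟫ ≤ k * ‖w‖ ^ 2 + 3 * ‖B‖ * τ * ‖w‖ := by
  have hτw : τ ≤ ‖w‖ := by
    have := abs_real_inner_le_norm u w
    rw [hu, one_mul, hτ, abs_neg] at this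
    exact (le_abs_self _).trans this
  obtain ⟨v, hv⟩ : ∃ v, v = w + τ • u := ⟨_, rfl⟩
  have huu : ⟪u, u⟫ = 1 := by rw [real_inner_self_eq_norm_sq, hu]; norm_num
  have huv : ⟪u, v⟫ = 0 := by
    rw [hv, inner_add_right, inner_smul_right, huu, hτ]; ring
  have hvw : ‖v‖ ^ 2 ≤ ‖w‖ ^ 2 := by
    rw [hv, norm_add_sq_real, norm_smul, hu, inner_smul_right, real_inner_comm,
      Real.norm_of_nonneg hτ0, hτ]
    nlinarith
  have hvw' : ‖v‖ ≤ ‖w‖ := le_of_sq_le_sq hvw (norm_nonneg _)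
  have hBv := hB v huv
  have hbd : ∀ a b : E n, |⟪B a, b⟫| ≤ ‖B‖ * ‖a‖ * ‖b‖ := fun a b =>
    (abs_real_inner_le_norm _ _).trans
      (mul_le_mul_of_nonneg_right (B.le_opNorm a) (norm_nonneg _))
  have hwv : w = v - τ • u := by rw [hv]; abel
  -- `v` is the projection of `w` to the complement of `u`. Each of the three terms involving `u` is
  -- at most `‖B‖ * τ * ‖w‖`.
  have e : ⟪B w, w⟫ = ⟪B v, v⟫ - τ * ⟪B v, u⟫ - τ * ⟪B u, v⟫ + τ * (τ * ⟪B u, u⟫) := by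
    rw [hwv, map_sub, map_smul, inner_sub_left, inner_sub_right, inner_sub_right,
      inner_smul_right, inner_smul_right, real_inner_smul_left, real_inner_smul_left]; ring
  have b1 := (abs_le.1 (hbd v u)).1
  have b2 := (abs_le.1 (hbd u v)).1
  have b3 := (abs_le.1 (hbd u u)).2
  rw [hu, mul_one] at b1 b2 b3
  rw [mul_one] at b3
  have hB0 := norm_nonneg B
  have b4 : ‖B‖ * ‖v‖ ≤ ‖B‖ * ‖w‖ := mul_le_mul_of_nonneg_left hvw' hB0
  have c1 : τ * (-⟪B v, u⟫) ≤ τ * (‖B‖ * ‖w‖) :=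
    mul_le_mul_of_nonneg_left (by linarith) hτ0
  have c2 : τ * (-⟪B u, v⟫) ≤ τ * (‖B‖ * ‖w‖) :=
    mul_le_mul_of_nonneg_left (by linarith) hτ0
  have c3 : τ * (τ * ⟪B u, u⟫) ≤ τ * (‖w‖ * ‖B‖) :=
    mul_le_mul_of_nonneg_left ((mul_le_mul_of_nonneg_left b3 hτ0).trans
      (mul_le_mul_of_nonneg_right hτw hB0)) hτ0
  have c4 : k * ‖v‖ ^ 2 ≤ k * ‖w‖ ^ 2 := mul_le_mul_of_nonneg_left hvw hk
  rw [e]; linarith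

/-- Balls of radius less than the reciprocal of a bound of the second fundamental form at `p` are
locally contained in the domain when tangent to the frontier at `p`. -/
lemma IsLocalDefining.exists_ball_inter_ball_subset {D U : Set (E n)} {ρ : E n → ℝ}
    {g : E n → E n} {p : E n} (h : IsLocalDefining D p U ρ g) (hp : p ∈ frontier D)
    (hD : IsOpen D) (hc : Convex ℝ D) (hne : D.Nonempty) {K r : ℝ} (hK : 0 ≤ K) (hr : 0 < r)
    (hKr : K * r < 1)
    (hcurv : ∀ v, ⟪g p, v⟫ = 0 → ⟪fderiv ℝ g p v, v⟫ ≤ K * ‖g p‖ * ‖v‖ ^ 2) :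
    ∃ η > 0, Metric.ball (p - r • (‖g p‖⁻¹ • g p)) r ∩ Metric.ball p η ⊆ D := by
  have hu := h.isSupport p ⟨hp, h.mem⟩
  set u := ‖g p‖⁻¹ • g p with hu_def
  obtain ⟨B, hB⟩ : ∃ B, B = fderiv ℝ g p := ⟨_, rfl⟩
  rw [← hB] at hcurv
  have hG : 0 < ‖g p‖ := norm_pos_iff.2 (h.ne p h.mem)
  have hgu : g p = ‖g p‖ • u := by rw [hu_def, smul_smul, mul_inv_cancel₀ hG.ne', one_smul]
  clear_value u
  obtain ⟨G, hGdef⟩ : ∃ G, G = ‖g p‖ := ⟨_, rfl⟩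
  rw [← hGdef] at hG hcurv hgu
  have hκ : 0 < 1 - K * r := by linarith
  -- The available margin is `τ * G * (1 - K * r)`. Since `‖w‖ ^ 2 < 2 * r * τ` in the ball, this
  -- error constant uses a quarter of it, and the radius chosen next keeps the mixed terms below
  -- another quarter.
  obtain ⟨η₀, hη₀, ht⟩ := h.exists_taylor hp (ε := G * (1 - K * r) / (8 * r)) (by positivity)
  have hb : 0 < 8 * (‖B‖ + 1) := by positivity
  refine ⟨min η₀ (G * (1 - K * r) / (8 * (‖B‖ + 1))), lt_min hη₀ (by positivity),
    hu.ball_inter_ball_subset hD hc hne hr (lt_min hη₀ (by positivity)) ?_⟩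
  rintro x ⟨hx1, hx2⟩ hxf
  set w := x - p with hw
  have hxw : x = p + w := by rw [hw]; abel
  rw [mem_ball_iff_norm] at hx2
  obtain ⟨hU, htay⟩ := ht w (hx2.trans_le (min_le_left _ _))
  have hwη : ‖w‖ * (8 * (‖B‖ + 1)) < G * (1 - K * r) := by
    rw [← lt_div_iff₀ hb]; exact hx2.trans_le (min_le_right _ _)
  have hρ : ρ (p + w) = 0 := by
    have : x ∈ frontier D ∩ U := ⟨hxf, hxw ▸ hU⟩
    rw [h.zero] at this; rw [← hxw]; exact this.2
  set τ := -⟪u, w⟫ with hτ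
  have hτ2 : ‖w‖ ^ 2 < 2 * r * τ := by
    rw [mem_ball_iff_norm, show x - (p - r • u) = w + r • u by rw [hw]; abel] at hx1
    have h2 := pow_lt_pow_left₀ hx1 (norm_nonneg _) two_ne_zero
    rw [norm_add_sq_real, norm_smul, hu.norm_eq, inner_smul_right, real_inner_comm,
      Real.norm_of_nonneg hr.le] at h2
    nlinarith
  have hτ0 : 0 < τ := by
    have : 0 < r * τ := by nlinarith [sq_nonneg ‖w‖]
    exact pos_of_mul_pos_right this hr.le
  have hQ := inner_apply_self_le B hu.norm_eq (w := w) (τ := τ) (by rw [hτ, neg_neg]) hτ0.le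
    (mul_nonneg hK hG.le)
    fun v hv => hcurv v (by rw [hgu, real_inner_smul_left, hv, mul_zero])
  have hgw : ⟪g p, w⟫ = -(G * τ) := by
    rw [hgu, real_inner_smul_left, hτ]; ring
  rw [hρ, hgw, ← hB] at htay
  have h5 := (abs_le.1 htay).2
  have d1 : K * G * ‖w‖ ^ 2 ≤ K * G * (2 * r * τ) := by gcongr
  have d2 : G * (1 - K * r) / (8 * r) * ‖w‖ ^ 2 ≤ G * (1 - K * r) / (8 * r) * (2 * r * τ) := by
    gcongr
  have d3 : G * (1 - K * r) / (8 * r) * (2 * r * τ) = τ * (G * (1 - K * r)) / 4 := by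
    field_simp; ring
  have d4 : τ * (‖w‖ * (8 * (‖B‖ + 1))) ≤ τ * (G * (1 - K * r)) := by gcongr
  have d5 : 0 < τ * (G * (1 - K * r)) := by positivity
  have d6 : 0 ≤ τ * ‖w‖ := by positivity
  linarith

/-! ### Normal curvatures and their supremum -/

/-- Orthogonality to the tangent space leaves only `u` and `-u`. The second is impossible, because a
small internally tangent ball shows that `p - t • u` lies in `D` for small positive `t`. -/
lemma IsOutwardUnitNormal.isSupport {k : WithTop ℕ∞} (hk : 2 ≤ k) {D : Set (E n)}
    (hD : IsBoundedRegularStrictlyConvexDomain k D) {p ν : E n} (hp : p ∈ frontier D)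
    (hν : IsOutwardUnitNormal D p ν) : IsSupport D p ν := by
  obtain ⟨u, hu⟩ := exists_isSupport hD.isOpen hD.convex hD.nonempty hp
  have huu : ⟪u, u⟫ = 1 := by rw [real_inner_self_eq_norm_sq, hu.norm_eq]; norm_num
  have h1 : ⟪u, ν - ⟪u, ν⟫ • u⟫ = 0 := by
    rw [inner_sub_right, inner_smul_right, huu]; ring
  have h2 : ⟪ν, ν - ⟪u, ν⟫ • u⟫ = 0 := hν.2.1 _ (hu.mem_tangentSpace hk hD h1)
  have h3 : ν = ⟪u, ν⟫ • u := by
    rw [← sub_eq_zero, ← inner_self_eq_zero (𝕜 := ℝ)]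
    conv_lhs => rw [inner_sub_left, real_inner_smul_left, h1, h2]
    ring
  have h4 : |⟪u, ν⟫| = 1 := by
    have := hν.1
    rwa [h3, norm_smul, hu.norm_eq, mul_one] at this
  rcases eq_or_eq_neg_of_abs_eq h4 with h5 | h5
  · rw [h5, one_smul] at h3; rwa [h3]
  · exfalso
    rw [h5, neg_one_smul] at h3
    obtain ⟨U, ρ, g, hg⟩ := exists_isLocalDefining hk hD hp
    have hG : 0 < ‖g p‖ := norm_pos_iff.2 (hg.ne p hg.mem)
    -- No sharp curvature bound is needed: the operator norm supplies `K`, and `r = 1 / (K + 1)`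
    -- gives `K * r < 1`.
    obtain ⟨η, hη, hsub⟩ := hg.exists_ball_inter_ball_subset hp hD.isOpen hD.convex hD.nonempty
      (K := ‖fderiv ℝ g p‖ / ‖g p‖) (r := (‖fderiv ℝ g p‖ / ‖g p‖ + 1)⁻¹) (by positivity)
      (by positivity) (by
        rw [mul_inv_lt_iff₀ (by positivity)]; linarith) (fun v _ => by
        rw [div_mul_cancel₀ _ hG.ne']
        calc _ ≤ ‖fderiv ℝ g p v‖ * ‖v‖ := real_inner_le_norm _ _
          _ ≤ (‖fderiv ℝ g p‖ * ‖v‖) * ‖v‖ := by gcongr; exact ContinuousLinearMap.le_opNorm _ _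
          _ = _ := by ring)
    rw [← hg.eq_of_isSupport p ⟨hp, hg.mem⟩ u hu] at hsub
    set r := (‖fderiv ℝ g p‖ / ‖g p‖ + 1)⁻¹
    have hr : 0 < r := by positivity
    have l1 : ∀ᶠ t in 𝓝[>] (0 : ℝ), t < r ∧ t < η :=
      ((eventually_lt_nhds hr).and (eventually_lt_nhds hη)).filter_mono nhdsWithin_le_nhds
    obtain ⟨t, ⟨⟨ht1, ht2⟩, ht3⟩, ht4⟩ := ((l1.and hν.2.2).and self_mem_nhdsWithin).exists
    have ht0 : 0 < t := ht4
    refine ht3 (subset_closure (hsub ⟨?_, ?_⟩))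
    · rw [h3, mem_ball_iff_norm, show p + t • -u - (p - r • u) = (r - t) • u by module, norm_smul,
        hu.norm_eq, mul_one, Real.norm_of_nonneg (by linarith)]
      linarith
    · rw [h3, mem_ball_iff_norm, add_sub_cancel_left, norm_smul, norm_neg, hu.norm_eq, mul_one,
        Real.norm_of_nonneg ht0.le]
      exact ht2

/-- The derivative of the unit normal field along a curve. -/
lemma IsLocalDefining.exists_hasDerivAt_normal {D U : Set (E n)} {ρ : E n → ℝ} {g : E n → E n}
    {p v : E n} (h : IsLocalDefining D p U ρ g) {c : ℝ → E n} (hc0 : c 0 = p)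
    (hc : HasDerivAt c v 0) (hv : ⟪g p, v⟫ = 0) :
    ∃ w, HasDerivAt (fun t => ‖g (c t)‖⁻¹ • g (c t)) w 0 ∧
      ⟪w, v⟫ = ‖g p‖⁻¹ * ⟪fderiv ℝ g p v, v⟫ := by
  have hne : g (c 0) ≠ 0 := by rw [hc0]; exact h.ne p h.mem
  have h1 : HasDerivAt (fun t => g (c t)) (fderiv ℝ g p v) 0 := by
    have hg : HasFDerivAt g (fderiv ℝ g p) (c 0) := hc0 ▸ h.hasFDerivAt_gradient
    exact hg.comp_hasDerivAt (0 : ℝ) hc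
  have h2 : DifferentiableAt ℝ (fun t => ‖g (c t)‖⁻¹) 0 :=
    (h1.differentiableAt.norm ℝ hne).inv (norm_ne_zero_iff.2 hne)
  refine ⟨_, h2.hasDerivAt.smul h1, ?_⟩
  -- Differentiating the factor `‖g‖⁻¹` contributes a multiple of `g p`, which is orthogonal to `v`.
  rw [inner_add_left, real_inner_smul_left, real_inner_smul_left, hc0, hv, mul_zero, add_zero]

lemma IsLocalDefining.eventually_mem_frontier_inter {D U : Set (E n)} {ρ : E n → ℝ} {g : E n → E n}
    {p v : E n} (h : IsLocalDefining D p U ρ g) {c : ℝ → E n}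
    (hc : IsCurveThrough (frontier D) p v c) :
    ∀ᶠ t in 𝓝 (0 : ℝ), c t ∈ frontier D ∩ U := by
  obtain ⟨hc0, hcS, hcd⟩ := hc
  have h2 : ∀ᶠ t in 𝓝 0, c t ∈ U :=
    hcd.continuousAt.eventually_mem (by rw [hc0]; exact h.isOpen.mem_nhds h.mem)
  exact hcS.and h2

lemma IsLocalDefining.hasNormalCurvature {D U : Set (E n)} {ρ : E n → ℝ} {g : E n → E n}
    {p v : E n} (h : IsLocalDefining D p U ρ g) (hp : p ∈ frontier D) (hv : ⟪g p, v⟫ = 0) :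
    HasNormalCurvature D p v (‖g p‖⁻¹ * ⟪fderiv ℝ g p v, v⟫) := by
  obtain ⟨c, hc⟩ := h.mem_tangentSpace ⟨hp, h.mem⟩ hv
  obtain ⟨w, hw, hwv⟩ := h.exists_hasDerivAt_normal hc.1 hc.2.2 hv
  exact ⟨c, _, w, hc, (h.eventually_mem_frontier_inter hc).mono
    fun t ht => (h.isSupport _ ht).isOutwardUnitNormal, hw, hwv.symm⟩

/-- Outward unit normals are unique, so every admissible field agrees with the normalized gradient
along the curve, and the curvature depends on neither the curve nor the field. -/
lemma IsLocalDefining.normalCurvature_eq {k : WithTop ℕ∞} (hk : 2 ≤ k) {D U : Set (E n)}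
    (hD : IsBoundedRegularStrictlyConvexDomain k D) {ρ : E n → ℝ} {g : E n → E n}
    {p v : E n} {κ : ℝ} (h : IsLocalDefining D p U ρ g) (hp : p ∈ frontier D)
    (hκ : HasNormalCurvature D p v κ) : κ = ‖g p‖⁻¹ * ⟪fderiv ℝ g p v, v⟫ := by
  obtain ⟨c, N, w, hc, hN, hNd, rfl⟩ := hκ
  have hv : ⟪g p, v⟫ = 0 := by
    have := (h.isSupport p ⟨hp, h.mem⟩).inner_tangent ⟨c, hc⟩
    rw [real_inner_smul_left] at this
    exact (mul_eq_zero.1 this).resolve_left (inv_ne_zero (norm_ne_zero_iff.2 (h.ne p h.mem)))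
  obtain ⟨w', hw', hwv⟩ := h.exists_hasDerivAt_normal hc.1 hc.2.2 hv
  have heq : N =ᶠ[𝓝 0] fun t => ‖g (c t)‖⁻¹ • g (c t) := by
    filter_upwards [hN, h.eventually_mem_frontier_inter hc] with t ht1 ht2
    exact h.eq_of_isSupport _ ht2 _ (ht1.isSupport hk hD ht2.1)
  rw [← hwv, hNd.unique (hw'.congr_of_eventuallyEq heq)]

lemma IsBoundedRegularStrictlyConvexDomain.isCompact_frontier {k : WithTop ℕ∞} {D : Set (E n)}
    (hD : IsBoundedRegularStrictlyConvexDomain k D) : IsCompact (frontier D) :=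
  Metric.isCompact_of_isClosed_isBounded isClosed_frontier
    (hD.bounded.closure.subset frontier_subset_closure)

/-- The normal curvatures of the frontier are bounded. -/
lemma exists_normalCurvature_le {k : WithTop ℕ∞} (hk : 2 ≤ k) {D : Set (E n)}
    (hD : IsBoundedRegularStrictlyConvexDomain k D) :
    ∃ C, 0 ≤ C ∧ ∀ p ∈ frontier D, ∀ v, ‖v‖ = 1 → ∀ κ, HasNormalCurvature D p v κ → κ ≤ C := by
  have key : ∃ C, ∀ p ∈ frontier D, p ∈ frontier D → ∀ v, ‖v‖ = 1 →
      ∀ κ, HasNormalCurvature D p v κ → κ ≤ C := by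
    refine hD.isCompact_frontier.induction_on
      (p := fun s => ∃ C : ℝ, ∀ p ∈ s, p ∈ frontier D → ∀ v, ‖v‖ = 1 →
        ∀ κ, HasNormalCurvature D p v κ → κ ≤ C) ⟨0, by simp⟩ ?_ ?_ ?_
    · rintro s t hst ⟨C, hC⟩
      exact ⟨C, fun p hp => hC p (hst hp)⟩
    · rintro s t ⟨C, hC⟩ ⟨C', hC'⟩
      refine ⟨max C C', fun p hp hpf v hv κ hκ => ?_⟩
      rcases hp with hp | hp
      · exact (hC p hp hpf v hv κ hκ).trans (le_max_left _ _)
      · exact (hC' p hp hpf v hv κ hκ).trans (le_max_right _ _)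
    · intro p hp
      obtain ⟨U, ρ, g, h⟩ := exists_isLocalDefining hk hD hp
      have hcont : ContinuousAt (fun q => ‖g q‖⁻¹ * ‖fderiv ℝ g q‖) p := by
        have hU := h.isOpen.mem_nhds h.mem
        have c1 : ContinuousAt g p := h.contDiff.continuousOn.continuousAt hU
        have c2 : ContinuousAt (fderiv ℝ g) p :=
          (h.contDiff.continuousOn_fderiv_of_isOpen h.isOpen le_rfl).continuousAt hU
        exact (c1.norm.inv₀ (norm_ne_zero_iff.2 (h.ne p h.mem))).mul c2.norm
      refine ⟨{q | q ∈ U ∧ ‖g q‖⁻¹ * ‖fderiv ℝ g q‖ < ‖g p‖⁻¹ * ‖fderiv ℝ g p‖ + 1},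
        mem_nhdsWithin_of_mem_nhds (inter_mem (h.isOpen.mem_nhds h.mem)
          (hcont.eventually_lt_const (lt_add_one _))), ‖g p‖⁻¹ * ‖fderiv ℝ g p‖ + 1, ?_⟩
      rintro q ⟨hqU, hq⟩ hqf v hv κ hκ
      rw [(h.of_mem hqU).normalCurvature_eq hk hD hqf hκ]
      refine le_trans ?_ hq.le
      refine mul_le_mul_of_nonneg_left ?_ (by positivity)
      have h1 := (fderiv ℝ g q).le_opNorm v
      have h2 := real_inner_le_norm (fderiv ℝ g q v) v
      rw [hv, mul_one] at h1 h2
      linarith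
  obtain ⟨C, hC⟩ := key
  exact ⟨max C 0, le_max_right _ _, fun p hp v hv κ hκ =>
    (hC p hp hp v hv κ hκ).trans (le_max_left _ _)⟩

lemma le_maxCurvature {k : WithTop ℕ∞} (hk : 2 ≤ k) {D : Set (E n)}
    (hD : IsBoundedRegularStrictlyConvexDomain k D) {p v : E n} {κ : ℝ} (hp : p ∈ frontier D)
    (hv : ‖v‖ = 1) (hκ : HasNormalCurvature D p v κ) : κ ≤ maxCurvature D := by
  obtain ⟨C, hC0, hC⟩ := exists_normalCurvature_le hk hD
  have h1 : ∀ q ∈ frontier D, ∀ x ∈ {κ | ∃ v ∈ tangentSpace (frontier D) q, ‖v‖ = 1 ∧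
      HasNormalCurvature D q v κ}, x ≤ C := by
    rintro q hq x ⟨v, -, hv, hx⟩
    exact hC q hq v hv x hx
  have h2 : κ ≤ maxCurvatureAt D p :=
    le_csSup ⟨C, h1 p hp⟩ ⟨v, (by obtain ⟨c, N, w, hc, -⟩ := hκ; exact ⟨c, hc⟩), hv, hκ⟩
  refine h2.trans (le_csSup ⟨C, ?_⟩ ⟨p, hp, rfl⟩)
  rintro _ ⟨q, hq, rfl⟩
  -- `0 ≤ C` covers the default value `0` of an empty supremum.
  exact Real.sSup_le (h1 q hq) hC0

lemma exists_unit_inner_eq_zero (hn : 2 ≤ n) (u : E n) : ∃ v : E n, ‖v‖ = 1 ∧ ⟪u, v⟫ = 0 := by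
  have h1 : LinearMap.ker (innerSL ℝ u : E n →ₗ[ℝ] ℝ) ≠ ⊥ :=
    LinearMap.ker_ne_bot_of_finrank_lt (by simp; omega)
  obtain ⟨v, hv, hv0⟩ := Submodule.exists_mem_ne_zero_of_ne_bot h1
  refine ⟨‖v‖⁻¹ • v, ?_, ?_⟩
  · rw [norm_smul, norm_inv, norm_norm, inv_mul_cancel₀ (norm_ne_zero_iff.2 hv0)]
  · have : ⟪u, v⟫ = 0 := by simpa using hv
    rw [inner_smul_right, this, mul_zero]

lemma maxCurvature_pos (hn : 2 ≤ n) {k : WithTop ℕ∞} (hk : 2 ≤ k) {D : Set (E n)}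
    (hD : IsBoundedRegularStrictlyConvexDomain k D) : 0 < maxCurvature D := by
  have : Nonempty (Fin n) := ⟨⟨0, by omega⟩⟩
  have hfr : (frontier D).Nonempty := by
    rw [nonempty_frontier_iff]
    refine ⟨hD.nonempty, fun h => ?_⟩
    have hb := hD.bounded
    rw [h] at hb
    exact NormedSpace.unbounded_univ ℝ (E n) hb
  obtain ⟨p, hp⟩ := hfr
  obtain ⟨U, ρ, g, h⟩ := exists_isLocalDefining hk hD hp
  obtain ⟨v, hv, hgv⟩ := exists_unit_inner_eq_zero hn (g p)
  have hκ := h.hasNormalCurvature hp hgv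
  exact (hD.strict p hp v (h.mem_tangentSpace ⟨hp, h.mem⟩ hgv) hv _ hκ).trans_le
    (le_maxCurvature hk hD hp hv hκ)

/-! ### Blaschke's rolling theorem -/

/-- Local version of Blaschke's rolling theorem. -/
lemma IsSupport.exists_ball_inter_ball_subset (hn : 2 ≤ n) {k : WithTop ℕ∞} (hk : 2 ≤ k)
    {D : Set (E n)} (hD : IsBoundedRegularStrictlyConvexDomain k D) {p u : E n}
    (hu : IsSupport D p u) {r : ℝ} (hr : 0 < r) (hr' : r < 1 / maxCurvature D) :
    ∃ η > 0, Metric.ball (p - r • u) r ∩ Metric.ball p η ⊆ D := by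
  have hκ := maxCurvature_pos hn hk hD
  obtain ⟨U, ρ, g, h⟩ := exists_isLocalDefining hk hD hu.mem
  have hG : 0 < ‖g p‖ := norm_pos_iff.2 (h.ne p h.mem)
  rw [h.eq_of_isSupport p ⟨hu.mem, h.mem⟩ u hu]
  refine h.exists_ball_inter_ball_subset hu.mem hD.isOpen hD.convex hD.nonempty hκ.le hr ?_ ?_
  · rwa [lt_div_iff₀ hκ, mul_comm] at hr'
  · intro v hv
    rcases eq_or_ne v 0 with rfl | hv0
    · simp
    have hvn : 0 < ‖v‖ := norm_pos_iff.2 hv0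
    have h1 : ‖‖v‖⁻¹ • v‖ = 1 := by
      rw [norm_smul, norm_inv, norm_norm, inv_mul_cancel₀ hvn.ne']
    have h2 := le_maxCurvature hk hD hu.mem h1 (h.hasNormalCurvature hu.mem
      (v := ‖v‖⁻¹ • v) (by rw [inner_smul_right, hv, mul_zero]))
    rw [map_smul, real_inner_smul_left, inner_smul_right] at h2
    field_simp at h2
    linarith

/-- A continuous function of one variable with local affine minorants at all points lies above its
minorant at the initial point. -/
lemma add_le_of_local_support {φ : ℝ → ℝ} {a : ℝ} (hφ : ContinuousOn φ (Icc 0 1))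
    (hloc : ∀ t ∈ Ioo (0 : ℝ) 1, ∃ b, ∀ᶠ s in 𝓝 t, φ t + b * (s - t) ≤ φ s)
    (h0 : ∀ᶠ s in 𝓝[>] (0 : ℝ), φ 0 + a * s ≤ φ s) : φ 0 + a ≤ φ 1 := by
  by_contra! hlt
  set m := φ 1 - φ 0 with hm
  set χ : ℝ → ℝ := fun s => φ s - φ 0 - s * m with hχ
  have hcont : ContinuousOn χ (Icc 0 1) := by fun_prop
  obtain ⟨t₁, ht₁, hmax⟩ := isCompact_Icc.exists_isMaxOn (nonempty_Icc.2 zero_le_one) hcont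
  set M := χ t₁
  have hle : ∀ s ∈ Icc (0 : ℝ) 1, χ s ≤ M := fun s hs => hmax hs
  have hM : 0 < M := by
    have l1 : ∀ᶠ s in 𝓝[>] (0 : ℝ), s < 1 :=
      (eventually_lt_nhds one_pos).filter_mono nhdsWithin_le_nhds
    obtain ⟨s, ⟨hs1, hs2⟩, hs3⟩ := ((h0.and l1).and self_mem_nhdsWithin).exists
    have hs0 : 0 < s := hs3
    have h1 := hle s ⟨hs0.le, hs2.le⟩
    have h2 : 0 < (a - m) * s := mul_pos (by linarith) hs0
    simp only [hχ] at h1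
    linarith
  have hAc : IsCompact {s ∈ Icc (0 : ℝ) 1 | χ s = M} := by
    have : {s ∈ Icc (0 : ℝ) 1 | χ s = M} = Icc 0 1 ∩ χ ⁻¹' {M} := rfl
    rw [this]
    exact isCompact_Icc.of_isClosed_subset (hcont.preimage_isClosed_of_isClosed isClosed_Icc
      isClosed_singleton) inter_subset_left
  -- At the leftmost maximum of `χ`, the affine minorant makes the values at `t - δ / 2` and `t + δ
  -- / 2` average at least `M`. Both then equal `M`, contradicting leftmost.
  obtain ⟨t, ⟨⟨ht0, ht1⟩, htM⟩, hmin⟩ := hAc.exists_isLeast ⟨t₁, ht₁, rfl⟩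
  have ht0' : 0 < t := lt_of_le_of_ne ht0 (by rintro rfl; simp [hχ] at htM; linarith)
  have ht1' : t < 1 := lt_of_le_of_ne ht1 (by rintro rfl; simp [hχ, hm] at htM; linarith)
  obtain ⟨b, hb⟩ := hloc t ⟨ht0', ht1'⟩
  obtain ⟨δ, hδ, hball⟩ := Metric.eventually_nhds_iff.1
    (hb.and (Ioo_mem_nhds ht0' ht1'))
  have e1 := hball (y := t - δ / 2) (by
    rw [Real.dist_eq, abs_lt]; constructor <;> linarith)
  have e2 := hball (y := t + δ / 2) (by
    rw [Real.dist_eq, abs_lt]; constructor <;> linarith)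
  have m1 := hle _ (Ioo_subset_Icc_self e1.2)
  have m2 := hle _ (Ioo_subset_Icc_self e2.2)
  have hc1 := e1.1
  have hc2 := e2.1
  have hmem : t - δ / 2 ∈ {s ∈ Icc (0 : ℝ) 1 | χ s = M} := by
    refine ⟨Ioo_subset_Icc_self e1.2, le_antisymm m1 ?_⟩
    simp only [hχ] at htM m1 m2 ⊢
    nlinarith
  have := hmin hmem
  linarith

/-- The support function of `D`. -/
def supportFunction (D : Set (E n)) (w : E n) : ℝ :=
  sSup ((fun z => ⟪w, z⟫) '' closure D)

lemma inner_le_supportFunction {D : Set (E n)} (hD : IsCompact (closure D)) {z : E n}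
    (hz : z ∈ closure D) (w : E n) : ⟪w, z⟫ ≤ supportFunction D w :=
  le_csSup (hD.image (by fun_prop)).bddAbove ⟨z, hz, rfl⟩

lemma continuous_supportFunction {D : Set (E n)} (hD : IsCompact (closure D)) :
    Continuous (supportFunction D) :=
  hD.continuous_sSup (f := fun w z : E n => ⟪w, z⟫) (by fun_prop)

lemma IsSupport.supportFunction_eq {D : Set (E n)} (hD : IsCompact (closure D)) {p u : E n}
    (hu : IsSupport D p u) : supportFunction D u = ⟪u, p⟫ := by
  refine le_antisymm (csSup_le ?_ ?_)
    (inner_le_supportFunction hD (frontier_subset_closure hu.mem) u)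
  · exact ⟨_, p, frontier_subset_closure hu.mem, rfl⟩
  · rintro _ ⟨z, hz, rfl⟩
    have := hu.inner_le_closure z hz
    rw [inner_sub_right] at this
    simpa using this

lemma supportFunction_smul {D : Set (E n)} {t : ℝ} (ht : 0 ≤ t) (w : E n) :
    supportFunction D (t • w) = t * supportFunction D w := by
  rw [supportFunction, supportFunction, ← smul_eq_mul, ← Real.sSup_smul_of_nonneg ht]
  congr 1
  ext x
  simp [Set.mem_smul_set, real_inner_smul_left]

lemma IsSupport.of_mem_closure {D : Set (E n)} (hD : IsOpen D) {p u : E n} (hp : p ∈ closure D)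
    (hu : ‖u‖ = 1) (hle : ∀ z ∈ D, ⟪u, z - p⟫ ≤ 0) : IsSupport D p u := by
  refine ⟨?_, hu, hle⟩
  rw [hD.frontier_eq]
  refine ⟨hp, fun hpD => ?_⟩
  have hlim : ∀ᶠ t in 𝓝[>] (0 : ℝ), p + t • u ∈ D := by
    have hcont : Continuous fun t : ℝ => p + t • u := by fun_prop
    exact (hcont.continuousAt.eventually_mem (hD.mem_nhds (by simpa using hpD))).filter_mono
      nhdsWithin_le_nhds
  obtain ⟨t, ht, ht0⟩ := (hlim.and self_mem_nhdsWithin).exists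
  have h1 := hle _ ht
  rw [add_sub_cancel_left, inner_smul_right, real_inner_self_eq_norm_sq, hu] at h1
  have : (0 : ℝ) < t := ht0
  linarith

lemma exists_isSupport_of_norm_eq_one {D : Set (E n)} (hD : IsOpen D) (hDc : IsCompact (closure D))
    (hne : D.Nonempty) {u : E n} (hu : ‖u‖ = 1) : ∃ p, IsSupport D p u := by
  obtain ⟨p, hp, hmax⟩ := hDc.exists_isMaxOn hne.closure
    (f := fun z => ⟪u, z⟫) (by fun_prop)
  refine ⟨p, IsSupport.of_mem_closure hD hp hu fun z hz => ?_⟩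
  have : ⟪u, z⟫ ≤ ⟪u, p⟫ := hmax (subset_closure hz)
  rw [inner_sub_right]; linarith

/-- The support function minus `r` times the norm has local linear minorants. -/
lemma IsSupport.eventually_inner_le (hn : 2 ≤ n) {k : WithTop ℕ∞} (hk : 2 ≤ k)
    {D : Set (E n)} (hD : IsBoundedRegularStrictlyConvexDomain k D) {p w : E n} (hw : w ≠ 0)
    (hu : IsSupport D p (‖w‖⁻¹ • w)) {r : ℝ} (hr : 0 < r) (hr' : r < 1 / maxCurvature D) :
    ∀ᶠ w' in 𝓝 w, ⟪p - r • (‖w‖⁻¹ • w), w'⟫ ≤ supportFunction D w' - r * ‖w'‖ := by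
  have hDc : IsCompact (closure D) := hD.bounded.isCompact_closure
  -- All points except `p` of the sphere of radius `r` internally tangent at `p` lie in the open
  -- ball of the larger radius `r'`, so those close to `p` lie in `D`.
  obtain ⟨r', hrr', hr'κ⟩ := exists_between hr'
  obtain ⟨η, hη, hsub⟩ := hu.exists_ball_inter_ball_subset hn hk hD (hr.trans hrr') hr'κ
  set u := ‖w‖⁻¹ • w with hu_def
  have hcont : ContinuousAt (fun w' : E n => p - r • u + r • (‖w'‖⁻¹ • w')) w :=
    continuousAt_const.add (((continuous_norm.continuousAt.inv₀ (norm_ne_zero_iff.2 hw)).smul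
      continuousAt_id).const_smul r)
  have hev := hcont.eventually_mem (Metric.isOpen_ball.mem_nhds
    (x := p - r • u + r • (‖w‖⁻¹ • w)) (s := Metric.ball p η)
    (by rw [← hu_def, sub_add_cancel]; exact Metric.mem_ball_self hη))
  clear_value u
  filter_upwards [hev, isOpen_ne.mem_nhds hw] with w' h1 h2
  have hw' : 0 < ‖w'‖ := norm_pos_iff.2 h2
  set u' := ‖w'‖⁻¹ • w' with hu'
  have hu'n : ‖u'‖ = 1 := by
    rw [hu', norm_smul, norm_inv, norm_norm, inv_mul_cancel₀ hw'.ne']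
  have h4 : ⟪w', u'⟫ = ‖w'‖ := by
    rw [hu', inner_smul_right, real_inner_self_eq_norm_sq]; field_simp
  clear_value u'
  have hz : p - r • u + r • u' ∈ closure D := by
    by_cases heq : u = u'
    · rw [← heq, sub_add_cancel]; exact frontier_subset_closure hu.mem
    · refine subset_closure (hsub ⟨?_, h1⟩)
      have hin : ⟪u, u'⟫ < 1 := (inner_lt_one_iff_real_of_norm_eq_one hu.norm_eq hu'n).2 heq
      rw [mem_ball_iff_norm, show p - r • u + r • u' - (p - r' • u) = (r' - r) • u + r • u' by
        module]
      refine lt_of_pow_lt_pow_left₀ 2 (hr.trans hrr').le ?_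
      rw [norm_add_sq_real, norm_smul, norm_smul, hu.norm_eq, hu'n, real_inner_smul_left,
        inner_smul_right, Real.norm_of_nonneg hr.le, Real.norm_of_nonneg (by linarith)]
      have : (r' - r) * r * ⟪u, u'⟫ < (r' - r) * r * 1 :=
        mul_lt_mul_of_pos_left hin (mul_pos (by linarith) hr)
      nlinarith
  have h3 := inner_le_supportFunction hDc hz w'
  rw [inner_add_right, inner_smul_right, h4, real_inner_comm] at h3
  linarith

/-- The local minorants are propagated along the segment from `u` to `w`. The vector `e` guarantees
that this segment avoids the origin, where directions cannot be normalized. -/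
lemma IsSupport.inner_le_of_independent (hn : 2 ≤ n) {k : WithTop ℕ∞} (hk : 2 ≤ k)
    {D : Set (E n)} (hD : IsBoundedRegularStrictlyConvexDomain k D) {p u w e : E n}
    (hu : IsSupport D p u) (hue : ⟪u, e⟫ = 0) (hwe : 0 < ⟪w, e⟫) {r : ℝ} (hr : 0 < r)
    (hr' : r < 1 / maxCurvature D) :
    ⟪p - r • u, w⟫ ≤ supportFunction D w - r * ‖w‖ := by
  have hDc : IsCompact (closure D) := hD.bounded.isCompact_closure
  have hu0 : u ≠ 0 := norm_ne_zero_iff.1 (by rw [hu.norm_eq]; exact one_ne_zero)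
  let W : ℝ → E n := fun t => u + t • (w - u)
  have hWc : Continuous W := by fun_prop
  have hW0 : ∀ t, W t ≠ 0 := fun t h0 => by
    have h1 : ⟪W t, e⟫ = t * ⟪w, e⟫ := by
      simp only [W]
      rw [inner_add_left, real_inner_smul_left, inner_sub_left, hue]; ring
    rw [h0, inner_zero_left] at h1
    rcases mul_eq_zero.1 h1.symm with h2 | h2
    · rw [h2] at h0; exact hu0 (by simpa [W] using h0)
    · exact hwe.ne' h2
  have hWs : ∀ (c : E n) (s t : ℝ), ⟪c, W s⟫ = ⟪c, W t⟫ + ⟪c, w - u⟫ * (s - t) := fun c s t => by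
    simp only [W]
    rw [inner_add_right, inner_add_right, inner_smul_right, inner_smul_right]; ring
  have hφc : Continuous fun t => supportFunction D (W t) - r * ‖W t‖ :=
    ((continuous_supportFunction hDc).comp hWc).sub (continuous_const.mul hWc.norm)
  have hsup : ∀ (t : ℝ) (q : E n), IsSupport D q (‖W t‖⁻¹ • W t) →
      ∀ᶠ s in 𝓝 t, supportFunction D (W t) - r * ‖W t‖ +
        ⟪q - r • (‖W t‖⁻¹ • W t), w - u⟫ * (s - t) ≤ supportFunction D (W s) - r * ‖W s‖ := by
    intro t q hq
    have hpos : 0 < ‖W t‖ := norm_pos_iff.2 (hW0 t)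
    filter_upwards [hWc.continuousAt.eventually (hq.eventually_inner_le hn hk hD (hW0 t) hr hr')]
      with s hs
    rw [hWs _ s t] at hs
    have h1 : supportFunction D (W t) = ⟪q, W t⟫ := by
      have h2 := hq.supportFunction_eq hDc
      rw [supportFunction_smul (by positivity), real_inner_smul_left, real_inner_comm] at h2
      exact mul_left_cancel₀ (inv_ne_zero hpos.ne') h2
    have h3 : ⟪q - r • (‖W t‖⁻¹ • W t), W t⟫ = ⟪q, W t⟫ - r * ‖W t‖ := by
      rw [inner_sub_left, real_inner_smul_left, real_inner_smul_left, real_inner_self_eq_norm_sq]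
      field_simp
    rw [h3] at hs
    rw [h1]; exact hs
  have hW00 : W 0 = u := by simp [W]
  have h0 := hsup 0 p (by rw [hW00, hu.norm_eq, inv_one, one_smul]; exact hu)
  rw [hW00, hu.norm_eq, inv_one, one_smul] at h0
  have hfin := add_le_of_local_support (φ := fun t => supportFunction D (W t) - r * ‖W t‖)
    (a := ⟪p - r • u, w - u⟫) hφc.continuousOn
    (fun t _ => by
      obtain ⟨q, hq⟩ := exists_isSupport_of_norm_eq_one hD.isOpen hDc hD.nonempty
        (u := ‖W t‖⁻¹ • W t) (by
          rw [norm_smul, norm_inv, norm_norm, inv_mul_cancel₀ (norm_ne_zero_iff.2 (hW0 t))])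
      exact ⟨_, hsup t q hq⟩)
    (by
      filter_upwards [h0.filter_mono nhdsWithin_le_nhds] with s hs
      simpa [hW00, hu.norm_eq] using hs)
  have hW1 : W 1 = w := by simp [W]
  simp only [hW00, hW1, hu.norm_eq] at hfin
  rw [hu.supportFunction_eq hDc] at hfin
  have h5 : ⟪p - r • u, u⟫ = ⟪u, p⟫ - r := by
    rw [inner_sub_left, real_inner_smul_left, real_inner_self_eq_norm_sq, hu.norm_eq,
      real_inner_comm]; ring
  rw [inner_sub_right, h5] at hfin
  linarith

/-- Blaschke's rolling theorem, in terms of supporting hyperplanes: a ball whose radius is the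
reciprocal of the maximal curvature, tangent to the frontier at `y`, lies in every supporting
half-space. -/
theorem IsSupport.inner_sub_le (hn : 2 ≤ n) {k : WithTop ℕ∞} (hk : 2 ≤ k)
    {D : Set (E n)} (hD : IsBoundedRegularStrictlyConvexDomain k D) {y p u v : E n}
    (hu : IsSupport D y u) (hv : IsSupport D p v) :
    ⟪v, y - p⟫ ≤ 1 / maxCurvature D * (⟪u, v⟫ - 1) := by
  have hDc : IsCompact (closure D) := hD.bounded.isCompact_closure
  obtain ⟨e, he, hue⟩ : ∃ e : E n, ‖e‖ = 1 ∧ ⟪u, e⟫ = 0 := exists_unit_inner_eq_zero hn u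
  obtain ⟨e, he, hue, hve⟩ : ∃ e : E n, ‖e‖ = 1 ∧ ⟪u, e⟫ = 0 ∧ 0 ≤ ⟪v, e⟫ := by
    rcases le_total 0 ⟪v, e⟫ with h | h
    · exact ⟨e, he, hue, h⟩
    · exact ⟨-e, by rw [norm_neg, he], by rw [inner_neg_right, hue, neg_zero],
        by rw [inner_neg_right]; linarith⟩
  have hR : 0 < 1 / maxCurvature D := one_div_pos.2 (maxCurvature_pos hn hk hD)
  have key : ∀ r, 0 < r → r < 1 / maxCurvature D → ⟪v, y - p⟫ ≤ r * (⟪u, v⟫ - 1) := by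
    intro r hr hr'
    -- Perturbing `v` along `e` also covers `v = -u`, where the segment from `u` to `v` passes
    -- through the origin. Letting `s → 0` removes the perturbation.
    have h1 : ∀ᶠ s in 𝓝[>] (0 : ℝ), ⟪y - r • u, v + s • e⟫ ≤
        supportFunction D (v + s • e) - r * ‖v + s • e‖ := by
      filter_upwards [self_mem_nhdsWithin] with s hs
      have hs0 : (0 : ℝ) < s := hs
      refine hu.inner_le_of_independent hn hk hD hue ?_ hr hr'
      rw [inner_add_left, real_inner_smul_left, real_inner_self_eq_norm_sq, he]
      nlinarith
    have hc1 : Continuous fun s : ℝ => ⟪y - r • u, v + s • e⟫ := by fun_prop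
    have hc2 : Continuous fun s : ℝ => supportFunction D (v + s • e) - r * ‖v + s • e‖ :=
      ((continuous_supportFunction hDc).comp (by fun_prop)).sub (by fun_prop)
    have h2 := le_of_tendsto_of_tendsto ((hc1.tendsto 0).mono_left nhdsWithin_le_nhds)
      ((hc2.tendsto 0).mono_left nhdsWithin_le_nhds) h1
    rw [zero_smul, add_zero, hv.supportFunction_eq hDc, hv.norm_eq, inner_sub_left,
      real_inner_smul_left, real_inner_comm] at h2
    rw [inner_sub_right]; linarith
  have hc : Continuous fun r : ℝ => r * (⟪u, v⟫ - 1) := by fun_prop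
  refine ge_of_tendsto (x := 𝓝[<] (1 / maxCurvature D))
    ((hc.tendsto (1 / maxCurvature D)).mono_left nhdsWithin_le_nhds) ?_
  filter_upwards [Ioo_mem_nhdsLT hR] with r hr using key r hr.1 hr.2

/-! ### Growth of the distance in slabs and length of curves -/

/-- Split `u` into its `v`-component, which sees at most `δ` of `x`, and an orthogonal remainder,
whose norm is the sine of the angle between `u` and `v`. -/
lemma inner_le_of_le_inner {u v x : E n} (hu : ‖u‖ = 1) (hv : ‖v‖ = 1) {a δ : ℝ} (ha : 0 ≤ a)
    (hauv : a ≤ ⟪u, v⟫) (hx : |⟪v, x⟫| ≤ δ) : ⟪u, x⟫ ≤ √(1 - a ^ 2) * ‖x‖ + δ := by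
  obtain ⟨c, hc⟩ : ∃ c, c = ⟪u, v⟫ := ⟨_, rfl⟩
  rw [← hc] at hauv
  have hc1 : c ≤ 1 := by
    have := real_inner_le_norm u v
    rwa [hu, hv, mul_one, ← hc] at this
  have h1 : ‖u - c • v‖ ^ 2 = 1 - c ^ 2 := by
    rw [norm_sub_sq_real, norm_smul, inner_smul_right, hu, hv, ← hc, Real.norm_eq_abs, mul_one,
      sq_abs]
    ring
  have h2 : ‖u - c • v‖ ≤ √(1 - a ^ 2) := by
    refine Real.le_sqrt_of_sq_le ?_
    rw [h1]; nlinarith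
  have h3 : ⟪u, x⟫ = c * ⟪v, x⟫ + ⟪u - c • v, x⟫ := by
    rw [inner_sub_left, real_inner_smul_left]; ring
  have h4 : c * ⟪v, x⟫ ≤ δ := by
    have h0 : 0 ≤ c := ha.trans hauv
    have := abs_nonneg ⟪v, x⟫
    calc c * ⟪v, x⟫ ≤ c * |⟪v, x⟫| := by gcongr; exact le_abs_self _
      _ ≤ 1 * |⟪v, x⟫| := by gcongr
      _ ≤ δ := by rwa [one_mul]
  have h5 : ⟪u - c • v, x⟫ ≤ √(1 - a ^ 2) * ‖x‖ :=
    (real_inner_le_norm _ _).trans (by gcongr)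
  linarith

/-- Inside a thin slab around a supporting hyperplane of `D`, and close to `D`, the distance
to `D` grows slowly. -/
lemma IsSupport.infDist_sub_infDist_le (hn : 2 ≤ n) {k : WithTop ℕ∞} (hk : 2 ≤ k)
    {D : Set (E n)} (hD : IsBoundedRegularStrictlyConvexDomain k D) {p v x x' : E n}
    (hv : IsSupport D p v) {δ d : ℝ} (hδ : δ ≤ 1 / maxCurvature D)
    (hx : |⟪v, x - p⟫| ≤ δ) (hx' : |⟪v, x' - p⟫| ≤ δ) (hxd : Metric.infDist x D ≤ d) :
    Metric.infDist x D - Metric.infDist x' D ≤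
      √(1 - ((1 / maxCurvature D - δ) / (1 / maxCurvature D + d)) ^ 2) * dist x x' + 2 * δ := by
  have hR : 0 < 1 / maxCurvature D := one_div_pos.2 (maxCurvature_pos hn hk hD)
  have hroll := fun (y u : E n) (hu : IsSupport D y u) => hu.inner_sub_le hn hk hD hv
  set R := 1 / maxCurvature D
  have hδ0 : 0 ≤ δ := (abs_nonneg _).trans hx
  have hs0 : 0 ≤ Metric.infDist x D := Metric.infDist_nonneg
  rcases hs0.eq_or_lt with h0 | hpos
  · rw [← h0]
    have : 0 ≤ Metric.infDist x' D := Metric.infDist_nonneg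
    have h2 : 0 ≤ √(1 - ((R - δ) / (R + d)) ^ 2) * dist x x' := by positivity
    linarith
  obtain ⟨y, hy, hxy⟩ := isClosed_closure.exists_infDist_eq_dist hD.nonempty.closure x
  have hproj : ∀ z ∈ closure D, ⟪x - y, z - y⟫ ≤ 0 := by
    rw [← norm_eq_iInf_iff_real_inner_le_zero hD.convex.closure hy, ← dist_eq_norm, ← hxy,
      Metric.infDist_eq_iInf]
    simp only [dist_eq_norm]
  rw [Metric.infDist_closure] at hxy
  obtain ⟨s, hs⟩ : ∃ s, s = Metric.infDist x D := ⟨_, rfl⟩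
  rw [← hs] at hxy hpos hxd ⊢
  rw [dist_eq_norm] at hxy
  obtain ⟨u, hu⟩ : ∃ u, u = s⁻¹ • (x - y) := ⟨_, rfl⟩
  have hxyu : x - y = s • u := by rw [hu, smul_smul, mul_inv_cancel₀ hpos.ne', one_smul]
  have hun : ‖u‖ = 1 := by
    rw [hu, norm_smul, norm_inv, Real.norm_of_nonneg hpos.le, ← hxy, inv_mul_cancel₀ hpos.ne']
  have hsup : IsSupport D y u := IsSupport.of_mem_closure hD.isOpen hy hun fun z hz => by
    rw [hu, real_inner_smul_left]
    exact mul_nonpos_of_nonneg_of_nonpos (by positivity) (hproj z (subset_closure hz))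
  -- With `x = y + s • u`, the rolling inequality and `-δ ≤ ⟪v, x - p⟫` combine to `R - δ ≤ ⟪u, v⟫ *
  -- (R + s)`.
  have hc : (R - δ) / (R + d) ≤ ⟪u, v⟫ := by
    have h1 := hroll y u hsup
    have h2 : ⟪v, x - p⟫ = ⟪v, y - p⟫ + s * ⟪u, v⟫ := by
      rw [show x - p = (y - p) + (x - y) by abel, hxyu, inner_add_right, inner_smul_right,
        real_inner_comm u v]
    have h3 := (abs_le.1 hx).1
    have h4 : R - δ ≤ ⟪u, v⟫ * (R + s) := by linarith
    have h5 : 0 ≤ ⟪u, v⟫ := nonneg_of_mul_nonneg_left (b := R + s) (by linarith) (by linarith)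
    rw [div_le_iff₀ (by linarith)]
    exact h4.trans (by gcongr)
  -- `D` lies behind the hyperplane through `y` normal to `u`, so the height of `x'` above it bounds
  -- its distance from below; for `x` there is equality.
  have hlow : ⟪u, x' - y⟫ ≤ Metric.infDist x' D := by
    refine (Metric.le_infDist hD.nonempty).2 fun z hz => ?_
    have h1 := hsup.inner_le z hz
    have h2 := real_inner_le_norm u (x' - z)
    rw [hun, one_mul, ← dist_eq_norm] at h2
    have h3 : ⟪u, x' - z⟫ = ⟪u, x' - y⟫ - ⟪u, z - y⟫ := by
      rw [← inner_sub_right]; congr 1; abel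
    linarith
  have hsx : s = ⟪u, x - y⟫ := by
    rw [hxyu, inner_smul_right, real_inner_self_eq_norm_sq, hun]; ring
  have hfin := inner_le_of_le_inner hun hv.norm_eq (x := x - x') (a := (R - δ) / (R + d))
    (δ := 2 * δ) (div_nonneg (by linarith) (by linarith)) hc (by
      have h1 := abs_le.1 hx
      have h2 := abs_le.1 hx'
      rw [show x - x' = (x - p) - (x' - p) by abel, inner_sub_right, abs_le]
      constructor <;> linarith [h1.1, h1.2, h2.1, h2.2])
  rw [dist_eq_norm]
  have h6 : ⟪u, x - x'⟫ = ⟪u, x - y⟫ - ⟪u, x' - y⟫ := by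
    rw [← inner_sub_right]; congr 1; abel
  linarith

/-- A curve covered by finitely many closed sets, in each of which `F` grows at most like `L` times
the distance, up to an error `C`. -/
lemma sub_le_of_finite_cover {X ι : Type*} [PseudoMetricSpace X] {S : ι → Set X}
    (hS : ∀ i, IsClosed (S i)) {F : X → ℝ} {L C : ℝ} (hL : 0 ≤ L) (hC : 0 ≤ C) {γ : ℝ → X} {b : ℝ} :
    ∀ (N : ℕ) (Δ : Finset ι) (a : ℝ), Δ.card ≤ N → a ≤ b → ContinuousOn γ (Icc a b) →
      (∀ t ∈ Icc a b, ∃ i ∈ Δ, γ t ∈ S i) →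
      (∀ i ∈ Δ, ∀ t ∈ Icc a b, ∀ t' ∈ Icc a b, γ t ∈ S i → γ t' ∈ S i →
        F (γ t') - F (γ t) ≤ L * dist (γ t) (γ t') + C) →
      eVariationOn γ (Icc a b) ≠ ⊤ →
      F (γ b) - F (γ a) ≤ L * (eVariationOn γ (Icc a b)).toReal + N * C := by
  classical
  intro N
  induction N with
  | zero =>
    intro Δ a hΔ hab _ hcov _ _
    obtain ⟨i, hi, -⟩ := hcov a ⟨le_rfl, hab⟩
    rw [Finset.card_eq_zero.1 (Nat.le_zero.1 hΔ)] at hi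
    simp at hi
  | succ N ih =>
    intro Δ a hΔ hab hγ hcov hF hV
    obtain ⟨i, hi, hai⟩ := hcov a ⟨le_rfl, hab⟩
    have hA : IsCompact (Icc a b ∩ γ ⁻¹' S i) :=
      isCompact_Icc.of_isClosed_subset (hγ.preimage_isClosed_of_isClosed isClosed_Icc (hS i))
        inter_subset_left
    -- `t` is the last visit to `S i`. Afterwards the other sets cover the curve, and being closed
    -- they also cover the time `t` when `t < b`.
    obtain ⟨t, ⟨ht, hti⟩, hmax⟩ := hA.exists_isGreatest ⟨a, ⟨le_rfl, hab⟩, hai⟩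
    have hadd := eVariationOn.Icc_add_Icc γ (s := univ) ht.1 ht.2 (mem_univ t)
    simp only [univ_inter] at hadd
    have hV1 : eVariationOn γ (Icc a t) ≠ ⊤ := fun h => hV (by rw [← hadd, h, top_add])
    have hV2 : eVariationOn γ (Icc t b) ≠ ⊤ := fun h => hV (by rw [← hadd, h, add_top])
    have hVadd : (eVariationOn γ (Icc a b)).toReal =
        (eVariationOn γ (Icc a t)).toReal + (eVariationOn γ (Icc t b)).toReal := by
      rw [← hadd, ENNReal.toReal_add hV1 hV2]
    have hd : dist (γ a) (γ t) ≤ (eVariationOn γ (Icc a t)).toReal := by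
      rw [dist_edist]
      exact ENNReal.toReal_mono hV1
        (eVariationOn.edist_le γ (left_mem_Icc.2 ht.1) (right_mem_Icc.2 ht.1))
    have h1 := hF i hi a ⟨le_rfl, hab⟩ t ht hai hti
    have h2 : L * dist (γ a) (γ t) ≤ L * (eVariationOn γ (Icc a t)).toReal := by gcongr
    have h3 : F (γ b) - F (γ t) ≤ L * (eVariationOn γ (Icc t b)).toReal + N * C := by
      rcases ht.2.eq_or_lt with rfl | htb
      · rw [sub_self]; positivity
      have hsub : Icc t b ⊆ Icc a b := Icc_subset_Icc_left ht.1
      refine ih (Δ.erase i) t ?_ ht.2 (hγ.mono hsub) ?_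
        (fun j hj s hs s' hs' => hF j (Finset.mem_of_mem_erase hj) s (hsub hs) s' (hsub hs')) hV2
      · rw [Finset.card_erase_of_mem hi]; omega
      · have hcl : IsClosed (Icc t b ∩ γ ⁻¹' ⋃ j ∈ Δ.erase i, S j) :=
          (hγ.mono hsub).preimage_isClosed_of_isClosed isClosed_Icc
            ((Δ.erase i).finite_toSet.isClosed_biUnion fun j _ => hS j)
        have hIoc : Ioc t b ⊆ Icc t b ∩ γ ⁻¹' ⋃ j ∈ Δ.erase i, S j := by
          intro s hs
          refine ⟨Ioc_subset_Icc_self hs, ?_⟩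
          obtain ⟨j, hj, hsj⟩ := hcov s (hsub (Ioc_subset_Icc_self hs))
          refine mem_biUnion (Finset.mem_erase.2 ⟨?_, hj⟩) hsj
          rintro rfl
          exact absurd (hmax ⟨hsub (Ioc_subset_Icc_self hs), hsj⟩) (not_le.2 hs.1)
        have hIcc := closure_minimal hIoc hcl
        rw [closure_Ioc htb.ne] at hIcc
        intro s hs
        simpa using (hIcc hs).2
    rw [hVadd]; push_cast
    linarith

/-- A curve from the frontier of `D` to distance `d` from `D`, contained in thin slabs around
finitely many supporting hyperplanes, is long. -/
lemma le_length_of_subset_slabs (hn : 2 ≤ n) {k : WithTop ℕ∞} (hk : 2 ≤ k)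
    {D : Set (E n)} (hD : IsBoundedRegularStrictlyConvexDomain k D) {Δ : Finset (E n)}
    {u : E n → E n} (hu : ∀ p ∈ Δ, IsSupport D p (u p)) {δ d : ℝ} (hδ0 : 0 ≤ δ)
    (hδ : δ ≤ 1 / maxCurvature D) (hd : 0 < d) {γ : ℝ → E n} (hγ : ContinuousOn γ (Icc 0 1))
    (hγΔ : ∀ t ∈ Icc (0 : ℝ) 1, ∃ p ∈ Δ, |⟪u p, γ t - p⟫| ≤ δ) (h0 : γ 0 ∈ frontier D)
    (h1 : d ≤ Metric.infDist (γ 1) D) (hV : eVariationOn γ (Icc 0 1) ≠ ⊤) :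
    d ≤ √(1 - ((1 / maxCurvature D - δ) / (1 / maxCurvature D + d)) ^ 2) *
      (eVariationOn γ (Icc 0 1)).toReal + Δ.card * (2 * δ) := by
  have hF : Continuous fun x => Metric.infDist x D := Metric.continuous_infDist_pt D
  have hFγ : ContinuousOn (fun t => Metric.infDist (γ t) D) (Icc 0 1) := hF.comp_continuousOn hγ
  have hA : IsCompact (Icc 0 1 ∩ (fun t => Metric.infDist (γ t) D) ⁻¹' Ici d) :=
    isCompact_Icc.of_isClosed_subset (hFγ.preimage_isClosed_of_isClosed isClosed_Icc isClosed_Ici)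
      inter_subset_left
  -- The slope bound needs distance at most `d` from `D`, so the curve is cut at the first time it
  -- reaches that distance.
  obtain ⟨τ, ⟨hτ, hτd⟩, hmin⟩ := hA.exists_isLeast ⟨1, ⟨zero_le_one, le_rfl⟩, h1⟩
  have hF0 : Metric.infDist (γ 0) D = 0 :=
    (Metric.mem_closure_iff_infDist_zero hD.nonempty).1 (frontier_subset_closure h0)
  have hτ0 : 0 < τ := lt_of_le_of_ne hτ.1 (by
    rintro rfl
    have : d ≤ Metric.infDist (γ 0) D := hτd
    linarith)
  have hsub : Icc 0 τ ⊆ Icc (0 : ℝ) 1 := Icc_subset_Icc_right hτ.2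
  have hle : ∀ t ∈ Icc 0 τ, Metric.infDist (γ t) D ≤ d := by
    have hcl : IsClosed (Icc 0 τ ∩ (fun t => Metric.infDist (γ t) D) ⁻¹' Iic d) :=
      (hFγ.mono hsub).preimage_isClosed_of_isClosed isClosed_Icc isClosed_Iic
    have hIco : Ico 0 τ ⊆ Icc 0 τ ∩ (fun t => Metric.infDist (γ t) D) ⁻¹' Iic d := by
      intro s hs
      refine ⟨Ico_subset_Icc_self hs, ?_⟩
      by_contra hcon
      have hds : d < Metric.infDist (γ s) D := not_le.1 hcon
      exact absurd (hmin ⟨hsub (Ico_subset_Icc_self hs), hds.le⟩) (not_le.2 hs.2)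
    have := closure_minimal hIco hcl
    rw [closure_Ico hτ0.ne] at this
    exact fun t ht => (this ht).2
  have hmono : eVariationOn γ (Icc 0 τ) ≤ eVariationOn γ (Icc 0 1) := eVariationOn.mono γ hsub
  have hmain := sub_le_of_finite_cover (S := fun p => {x | |⟪u p, x - p⟫| ≤ δ})
    (fun p => isClosed_le (by fun_prop) continuous_const)
    (F := fun x => Metric.infDist x D) (C := 2 * δ) (γ := γ) (b := τ)
    (Real.sqrt_nonneg (1 - ((1 / maxCurvature D - δ) / (1 / maxCurvature D + d)) ^ 2))
    (by linarith) Δ.card Δ 0 le_rfl hτ.1 (hγ.mono hsub) (fun t ht => hγΔ t (hsub ht))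
    (fun p hp t ht t' ht' hx hx' => by
      rw [dist_comm]
      exact (hu p hp).infDist_sub_infDist_le hn hk hD hδ hx' hx (hle t' ht'))
    (ne_top_of_le_ne_top hV hmono)
  simp only [hF0, sub_zero] at hmain
  refine (le_trans hτd hmain).trans ?_
  gcongr

/-! ### Tangent nets covering Lipschitz arcs -/

/-- `α` is the image of the unit interval under a Lipschitz curve. -/
def IsLipschitzArc (α : Set (E n)) : Prop :=
  ∃ (K : ℝ) (c : ℝ → E n), 0 ≤ K ∧
    (∀ s ∈ Icc (0 : ℝ) 1, ∀ t ∈ Icc (0 : ℝ) 1, ‖c t - c s‖ ≤ K * |t - s|) ∧ α = c '' Icc 0 1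

lemma isLipschitzArc_of_contDiffOn {a b : ℝ} (hab : a < b) {c : ℝ → E n}
    (hc : ContDiffOn ℝ 1 c (Icc a b)) : IsLipschitzArc (c '' Icc a b) := by
  have hcont := hc.continuousOn_derivWithin (uniqueDiffOn_Icc hab) le_rfl
  obtain ⟨C, hC⟩ := isCompact_Icc.exists_bound_of_continuousOn hcont
  have hC0 : 0 ≤ C := (norm_nonneg _).trans (hC a (left_mem_Icc.2 hab.le))
  have hba : 0 < b - a := by linarith
  have hmem : ∀ t ∈ Icc (0 : ℝ) 1, (b - a) * t + a ∈ Icc a b := fun t ht =>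
    ⟨by nlinarith [ht.1], by nlinarith [ht.2]⟩
  refine ⟨C * (b - a), fun t => c ((b - a) * t + a), by positivity, fun s hs t ht => ?_, ?_⟩
  · have := (convex_Icc a b).norm_image_sub_le_of_norm_derivWithin_le
      (hc.differentiableOn (by norm_num)) hC (hmem s hs) (hmem t ht)
    rwa [show (b - a) * t + a - ((b - a) * s + a) = (b - a) * (t - s) by ring, norm_mul,
      Real.norm_of_nonneg hba.le, ← mul_assoc, Real.norm_eq_abs] at this
  · have himg : (fun t => (b - a) * t + a) '' Icc 0 1 = Icc a b := by
      rw [image_affine_Icc' hba]; simp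
    conv_lhs => rw [← himg, image_image]

lemma IsImmersedCompactArc.isLipschitzArc {r : WithTop ℕ∞} (hr : 1 ≤ r) {α : Set (E n)}
    (h : IsImmersedCompactArc r α) : IsLipschitzArc α := by
  obtain ⟨a, b, c, hab, hc, -, rfl⟩ := h
  exact isLipschitzArc_of_contDiffOn hab (hc.of_le hr)

lemma IsImmersedClosedCurve.isLipschitzArc {r : WithTop ℕ∞} (hr : 1 ≤ r) {α : Set (E n)}
    (h : IsImmersedClosedCurve r α) : IsLipschitzArc α := by
  obtain ⟨L, c, hL, hper, hc, -, rfl⟩ := h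
  rw [← hper.image_Icc hL 0, zero_add]
  exact isLipschitzArc_of_contDiffOn hL (hc.of_le hr).contDiffOn

/-- The frontier stays quadratically close to its tangent hyperplanes. -/
lemma mem_thickening_affineTangentSpace (hn : 2 ≤ n) {k : WithTop ℕ∞} (hk : 2 ≤ k)
    {D : Set (E n)} (hD : IsBoundedRegularStrictlyConvexDomain k D) {p q : E n}
    (hp : p ∈ frontier D) (hq : q ∈ frontier D) {δ : ℝ}
    (hδ : maxCurvature D / 2 * ‖q - p‖ ^ 2 < δ) :
    q ∈ Metric.thickening δ (affineTangentSpace (frontier D) p) := by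
  have hκ := maxCurvature_pos hn hk hD
  obtain ⟨u, hu⟩ := exists_isSupport hD.isOpen hD.convex hD.nonempty hp
  obtain ⟨v, hv⟩ := exists_isSupport hD.isOpen hD.convex hD.nonempty hq
  have huu : ⟪u, u⟫ = 1 := by rw [real_inner_self_eq_norm_sq, hu.norm_eq]; norm_num
  have h1 : ⟪v, p - q⟫ ≤ 1 / maxCurvature D * (⟪u, v⟫ - 1) := hu.inner_sub_le hn hk hD hv
  have h2 : ⟪u, q - p⟫ ≤ 0 := hu.inner_le_closure q (frontier_subset_closure hq)
  obtain ⟨s, hs⟩ : ∃ s, s = -⟪u, q - p⟫ := ⟨_, rfl⟩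
  have hbound : s ≤ maxCurvature D / 2 * ‖q - p‖ ^ 2 := by
    have hR : 0 < 1 / maxCurvature D := one_div_pos.2 hκ
    -- By rolling, `q` is outside the open ball of radius `1 / maxCurvature D` internally tangent at
    -- `p`. Squaring bounds the depth `s` of `q` below the tangent hyperplane.
    have h3 : 1 / maxCurvature D ≤ ‖q - p + (1 / maxCurvature D) • u‖ := by
      have h4 := real_inner_le_norm v (q - p + (1 / maxCurvature D) • u)
      have h5 : ⟪v, p - q⟫ = -⟪v, q - p⟫ := by rw [← inner_neg_right, neg_sub]
      rw [hv.norm_eq, one_mul, inner_add_right, inner_smul_right, real_inner_comm u v] at h4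
      linarith
    have h6 := pow_le_pow_left₀ hR.le h3 2
    rw [norm_add_sq_real, norm_smul, hu.norm_eq, mul_one, Real.norm_of_nonneg hR.le,
      inner_smul_right, real_inner_comm] at h6
    have h7 : 2 * (1 / maxCurvature D * s) ≤ ‖q - p‖ ^ 2 := by rw [hs]; linarith
    calc s = maxCurvature D / 2 * (2 * (1 / maxCurvature D * s)) := by field_simp
      _ ≤ _ := by gcongr
  refine Metric.mem_thickening_iff.2 ⟨q + s • u, ⟨q + s • u - p, ?_, add_sub_cancel p _⟩, ?_⟩
  · refine hu.mem_tangentSpace hk hD ?_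
    rw [show q + s • u - p = (q - p) + s • u by abel, inner_add_right, inner_smul_right, huu, hs]
    ring
  · rw [dist_eq_norm, sub_add_cancel_left, norm_neg, norm_smul, hu.norm_eq,
      Real.norm_of_nonneg (by linarith), mul_one]
    linarith

/-- A set in the frontier which is the union of `m` Lipschitz arcs is covered by tangent nets whose
number of hyperplanes is small compared to their radius. -/
lemma exists_net_covering (hn : 2 ≤ n) {k : WithTop ℕ∞} (hk : 2 ≤ k)
    {D : Set (E n)} (hD : IsBoundedRegularStrictlyConvexDomain k D) {m : ℕ} {α : Fin m → Set (E n)}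
    (hα : ∀ i, IsLipschitzArc (α i)) (hαD : (⋃ i, α i) ⊆ frontier D) :
    ∃ C : ℝ, 0 < C ∧ ∀ M : ℕ, 0 < M → ∃ Δ : Finset (E n), (Δ : Set (E n)) ⊆ frontier D ∧
      Δ.card ≤ m * (M + 1) ∧ (⋃ i, α i) ⊆
        Metric.thickening (C / M ^ 2) (⋃ p ∈ Δ, affineTangentSpace (frontier D) p) := by
  classical
  choose K c hK0 hK hc using hα
  have hκ := maxCurvature_pos hn hk hD
  have hcD : ∀ i, ∀ t ∈ Icc (0 : ℝ) 1, c i t ∈ frontier D := fun i t ht =>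
    hαD (mem_iUnion.2 ⟨i, by rw [hc i]; exact ⟨t, ht, rfl⟩⟩)
  have hsum0 : 0 ≤ ∑ i, K i := Finset.sum_nonneg fun i _ => hK0 i
  -- The sum dominates every Lipschitz constant, and consecutive nodes are `1 / M` apart in
  -- parameter. The added `1` makes the inclusion strict and `C` positive.
  refine ⟨maxCurvature D / 2 * (∑ i, K i) ^ 2 + 1, by positivity, fun M hM => ?_⟩
  have hM' : (0 : ℝ) < M := by exact_mod_cast hM
  have hnode : ∀ j ∈ Finset.range (M + 1), (j / M : ℝ) ∈ Icc (0 : ℝ) 1 := fun j hj => by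
    have : (j : ℝ) ≤ M := by exact_mod_cast Nat.lt_succ_iff.1 (Finset.mem_range.1 hj)
    exact ⟨by positivity, div_le_one_of_le₀ this hM'.le⟩
  refine ⟨(Finset.univ ×ˢ Finset.range (M + 1)).image
    (fun x : Fin m × ℕ => c x.1 (x.2 / M : ℝ)), ?_, ?_, ?_⟩
  · intro p hp
    obtain ⟨x, hx, rfl⟩ := Finset.mem_image.1 (Finset.mem_coe.1 hp)
    exact hcD _ _ (hnode _ (Finset.mem_product.1 hx).2)
  · refine Finset.card_image_le.trans ?_
    simp [Finset.card_product]
  · refine iUnion_subset fun i => ?_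
    rw [hc i]
    rintro _ ⟨t, ht, rfl⟩
    have hjle : ⌊t * M⌋₊ ≤ M := by
      refine Nat.floor_le_of_le ?_
      nlinarith [ht.2]
    have hj : ⌊t * M⌋₊ ∈ Finset.range (M + 1) := Finset.mem_range.2 (by omega)
    have hfl1 := Nat.floor_le (mul_nonneg ht.1 hM'.le)
    have hfl2 := (Nat.lt_floor_add_one (t * M)).le
    have hdist : |t - ⌊t * M⌋₊ / M| ≤ 1 / M := by
      rw [show t - ⌊t * M⌋₊ / M = (t * M - ⌊t * M⌋₊) / M by field_simp,
        abs_of_nonneg (div_nonneg (by linarith) hM'.le)]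
      gcongr; linarith
    have hmem : c i (⌊t * M⌋₊ / M : ℝ) ∈ (Finset.univ ×ˢ Finset.range (M + 1)).image
        (fun x : Fin m × ℕ => c x.1 (x.2 / M : ℝ)) :=
      Finset.mem_image.2 ⟨(i, ⌊t * M⌋₊), Finset.mem_product.2 ⟨Finset.mem_univ _, hj⟩, rfl⟩
    refine Metric.thickening_subset_of_subset _ (subset_biUnion_of_mem
      (u := fun p => affineTangentSpace (frontier D) p) hmem) ?_
    refine mem_thickening_affineTangentSpace hn hk hD (hcD _ _ (hnode _ hj)) (hcD _ _ ht) ?_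
    have h1 := hK i _ (hnode _ hj) t ht
    have h2 : ‖c i t - c i (⌊t * M⌋₊ / M : ℝ)‖ ≤ (∑ i, K i) * (1 / M) :=
      h1.trans (mul_le_mul (Finset.single_le_sum (fun i _ => hK0 i) (Finset.mem_univ i)) hdist
        (abs_nonneg _) hsum0)
    calc _ ≤ maxCurvature D / 2 * ((∑ i, K i) * (1 / M)) ^ 2 := by gcongr
      _ = maxCurvature D / 2 * (∑ i, K i) ^ 2 / M ^ 2 := by field_simp
      _ < _ := by gcongr; linarith

/-! ### Limit of thin nets and conclusion -/

lemma exists_abs_inner_le_of_mem_thickening {D : Set (E n)} {Δ : Finset (E n)} {u : E n → E n}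
    (hu : ∀ p ∈ Δ, IsSupport D p (u p)) {δ : ℝ} {x : E n}
    (hx : x ∈ Metric.thickening δ (⋃ p ∈ Δ, affineTangentSpace (frontier D) p)) :
    ∃ p ∈ Δ, |⟪u p, x - p⟫| ≤ δ := by
  obtain ⟨z, hz, hxz⟩ := Metric.mem_thickening_iff.1 hx
  obtain ⟨p, hp, v, hv, rfl⟩ := mem_iUnion₂.1 hz
  refine ⟨p, hp, ?_⟩
  have h1 := (hu p hp).inner_tangent hv
  have h2 := abs_real_inner_le_norm (u p) (x - (p + v))
  rw [(hu p hp).norm_eq, one_mul, ← dist_eq_norm] at h2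
  rw [show x - p = x - (p + v) + v by abel, inner_add_right, h1, add_zero]
  exact h2.trans hxz.le

lemma setDist_nonneg (A B : Set (E n)) : 0 ≤ setDist A B := by
  refine Real.sInf_nonneg ?_
  rintro _ ⟨a, -, b, -, rfl⟩
  exact dist_nonneg

lemma setDist_le_infDist {A B : Set (E n)} (hA : A.Nonempty) {x : E n} (hx : x ∈ B) :
    setDist A B ≤ Metric.infDist x A := by
  refine (Metric.le_infDist hA).2 fun a ha => ?_
  rw [dist_comm]
  refine csInf_le ⟨0, ?_⟩ ⟨a, ha, x, hx, rfl⟩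
  rintro _ ⟨a, -, b, -, rfl⟩
  exact dist_nonneg

/-- This explains the formula for `boldDist`: it is the length needed to gain distance `d` at the
limiting rate, since `1 - (R / (R + d)) ^ 2 = d * (d + 2 * R) / (R + d) ^ 2`. -/
lemma sqrt_mul_eq {R d : ℝ} (hR : 0 < R) (hd : 0 < d) :
    √(1 - (R / (R + d)) ^ 2) * ((d + R) * √(d / (d + 2 * R))) = d := by
  have h1 : 0 ≤ 1 - (R / (R + d)) ^ 2 := by
    have : R / (R + d) ≤ 1 := div_le_one_of_le₀ (by linarith) (by linarith)
    have h0 : 0 ≤ R / (R + d) := by positivity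
    nlinarith
  rw [mul_left_comm, ← Real.sqrt_mul h1,
    show (1 - (R / (R + d)) ^ 2) * (d / (d + 2 * R)) = (d / (d + R)) ^ 2 by field_simp; ring,
    Real.sqrt_sq (by positivity)]
  field_simp

/-- For fine enough nets the lower bound of the length is not destroyed by their thickness. -/
lemma eventually_sqrt_mul_add_lt {R d ε C : ℝ} (m : ℕ) (hR : 0 < R) (hd : 0 < d) (hε : 0 < ε) :
    ∀ᶠ M : ℕ in atTop, √(1 - ((R - C / M ^ 2) / (R + d)) ^ 2) *
      ((d + R) * √(d / (d + 2 * R)) - ε) + (m * (M + 1) : ℕ) * (2 * (C / M ^ 2)) < d := by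
  have hinv : Tendsto (fun M : ℕ => (M : ℝ)⁻¹) atTop (𝓝 0) := tendsto_inv_atTop_nhds_zero_nat
  have hC : Tendsto (fun M : ℕ => C / (M : ℝ) ^ 2) atTop (𝓝 0) := by
    have := (hinv.pow 2).const_mul C
    simpa [div_eq_mul_inv] using this
  have hN : Tendsto (fun M : ℕ => ((m * (M + 1) : ℕ) : ℝ) * (2 * (C / (M : ℝ) ^ 2)))
      atTop (𝓝 0) := by
    have h1 : Tendsto (fun M : ℕ => 2 * m * C * ((M : ℝ)⁻¹ + (M : ℝ)⁻¹ ^ 2)) atTop (𝓝 0) := by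
      simpa using (hinv.add (hinv.pow 2)).const_mul (2 * m * C)
    refine h1.congr' ?_
    filter_upwards [eventually_gt_atTop 0] with M hM
    have : (M : ℝ) ≠ 0 := by positivity
    push_cast
    field_simp
  have hcont : Continuous fun x : ℝ => √(1 - ((R - x) / (R + d)) ^ 2) *
      ((d + R) * √(d / (d + 2 * R)) - ε) := by fun_prop
  have hlim := ((hcont.tendsto 0).comp hC).add hN
  refine hlim.eventually_lt_const ?_
  -- The limit is `d` minus `ε` times the positive limiting rate, hence strictly below `d`.
  rw [sub_zero, mul_sub, sqrt_mul_eq hR hd, add_zero]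
  have : 0 < √(1 - (R / (R + d)) ^ 2) := by
    refine lt_of_le_of_ne (Real.sqrt_nonneg _) fun h0 => ?_
    have := sqrt_mul_eq hR hd
    rw [← h0, zero_mul] at this
    exact hd.ne this
  nlinarith

end TangentNet

end

theorem mainTheorem7 (n : ℕ) (hn : 2 ≤ n) (k r : WithTop ℕ∞) (hk : 2 ≤ k) (hr : 1 ≤ r)
    (D D' : Set (TangentNet.E n))
    (hD : TangentNet.IsBoundedRegularStrictlyConvexDomain k D)
    (hD' : TangentNet.IsBoundedRegularStrictlyConvexDomain k D')
    (hDD' : TangentNet.RelativelyCompactIn D D')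
    (m : ℕ) (α : Fin m → Set (TangentNet.E n))
    (hα : ∀ i, TangentNet.IsImmersedCompactArc r (α i) ∨ TangentNet.IsImmersedClosedCurve r (α i))
    (hαD : (⋃ i, α i) ⊆ frontier D)
    (ε : ℝ) (hε : 0 < ε) :
    ∃ (δ : ℝ) (T : Set (TangentNet.E n)), δ < ε ∧ TangentNet.IsTangentNet D δ T ∧
      (⋃ i, α i) ⊆ T ∧
      ∀ γ : ℝ → TangentNet.E n, TangentNet.IsJordanArc γ → γ '' Icc 0 1 ⊆ T →
        γ 0 ∈ frontier D → γ 1 ∈ frontier D' →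
        ENNReal.ofReal (TangentNet.boldDist D D' - ε) < eVariationOn γ (Icc 0 1) := by
  have hR : 0 < 1 / TangentNet.maxCurvature D :=
    one_div_pos.2 (TangentNet.maxCurvature_pos hn hk hD)
  obtain ⟨C, hC, hnet⟩ := TangentNet.exists_net_covering hn hk hD
    (fun i => (hα i).elim (fun h => h.isLipschitzArc hr) fun h => h.isLipschitzArc hr) hαD
  have hbold : TangentNet.boldDist D D' =
      (TangentNet.setDist D (frontier D') + 1 / TangentNet.maxCurvature D) *
      √(TangentNet.setDist D (frontier D') /
        (TangentNet.setDist D (frontier D') + 2 * (1 / TangentNet.maxCurvature D))) := by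
    rw [TangentNet.boldDist, mul_one_div]
  have hd0 := TangentNet.setDist_nonneg D (frontier D')
  set d := TangentNet.setDist D (frontier D') with hd_def
  -- For `d = 0` the formula gives `boldDist D D' = 0`, so the estimate matters only for positive
  -- `d`.
  have hev : ∀ᶠ M : ℕ in atTop, 0 < d →
      √(1 - ((1 / TangentNet.maxCurvature D - C / M ^ 2) /
        (1 / TangentNet.maxCurvature D + d)) ^ 2) * (TangentNet.boldDist D D' - ε) +
        (m * (M + 1) : ℕ) * (2 * (C / M ^ 2)) < d := by
    rcases hd0.eq_or_lt with h0 | hpos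
    · exact Eventually.of_forall fun M h => absurd h0 h.ne
    · filter_upwards [TangentNet.eventually_sqrt_mul_add_lt (C := C) m hR hpos hε] with M hM _
      rw [hbold]; exact hM
  have hlim : Tendsto (fun M : ℕ => C / (M : ℝ) ^ 2) atTop (𝓝 0) := by
    have := ((tendsto_inv_atTop_nhds_zero_nat (𝕜 := ℝ)).pow 2).const_mul C
    simpa [div_eq_mul_inv] using this
  obtain ⟨M, ⟨⟨hM, hMε⟩, hMR⟩, hM0⟩ := (((hev.and (hlim.eventually_lt_const hε)).and
    (hlim.eventually_lt_const hR)).and (eventually_gt_atTop 0)).exists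
  obtain ⟨Δ, hΔD, hΔcard, hcov⟩ := hnet M hM0
  have hδ : 0 < C / (M : ℝ) ^ 2 := by positivity
  refine ⟨C / (M : ℝ) ^ 2, _, hMε, ⟨hδ, Δ, hΔD, rfl⟩, hcov, ?_⟩
  rintro γ ⟨hγ, hinj⟩ hγT hγ0 hγ1
  have h01 : (0 : ℝ) ∈ Icc (0 : ℝ) 1 := left_mem_Icc.2 zero_le_one
  have h11 : (1 : ℝ) ∈ Icc (0 : ℝ) 1 := right_mem_Icc.2 zero_le_one
  -- When the bound is nonpositive, strictness comes from injectivity: distinct endpoints give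
  -- positive length.
  rcases le_or_gt (TangentNet.boldDist D D' - ε) 0 with hle | hlt
  · rw [ENNReal.ofReal_of_nonpos hle]
    refine lt_of_lt_of_le ?_ (eVariationOn.edist_le γ h01 h11)
    exact edist_pos.2 fun h => zero_ne_one (hinj h01 h11 h)
  by_contra! hcon
  have hV : eVariationOn γ (Icc 0 1) ≠ ⊤ := ne_top_of_le_ne_top ENNReal.ofReal_ne_top hcon
  have hV' : (eVariationOn γ (Icc 0 1)).toReal ≤ TangentNet.boldDist D D' - ε :=
    ENNReal.toReal_le_of_le_ofReal hlt.le hcon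
  have hdpos : 0 < d := by
    refine hd0.lt_of_ne fun h0 => ?_
    rw [hbold, ← h0, zero_div, Real.sqrt_zero, mul_zero] at hlt
    linarith
  have hsupp : ∀ p ∈ Δ, ∃ u, TangentNet.IsSupport D p u := fun p hp =>
    TangentNet.exists_isSupport hD.isOpen hD.convex hD.nonempty (hΔD hp)
  choose! u hu using hsupp
  have hlen := TangentNet.le_length_of_subset_slabs hn hk hD hu hδ.le hMR.le hdpos hγ
    (fun t ht => TangentNet.exists_abs_inner_le_of_mem_thickening hu (hγT ⟨t, ht, rfl⟩)) hγ0
    (TangentNet.setDist_le_infDist hD.nonempty hγ1) hV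
  refine absurd (hM hdpos) (not_lt.2 (hlen.trans ?_))
  have hcard : (Δ.card : ℝ) ≤ (m * (M + 1) : ℕ) := by exact_mod_cast hΔcard
  gcongr
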